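/- **Setting.** Let $q$ be a power of $2$, $\mathbb F_q$ the field with $q$ elements, $K=\mathbb F_q(t)$, and let $c\in\mathbb F_q$ be such that $X^2+X+c$ is irreducible over $\mathbb F_q$. For an $\mathbb F_q[t]$-algebra $R$ let $\mathcal A_R$ be the quaternion algebra over $R$ with $R$-basis $1,Z,F,ZF$ and relations $$Z^2+Z=c,\qquad F^2=t,\qquad FZ=(Z+1)F .$$ Let $\mathbb F_q[Z]=\mathbb F_q\oplus\mathbb F_qZ\cong\mathbb F_{q^2}$, with conjugation $\alpha\mapsto\bar\alpha$ (so $\bar Z=Z+1$) and norm $N(\alpha)=\alpha\bar\alpha\in\mathbb F_q$. Let $S=\{0,\infty\}\cup S_0$ with $S_0\subseteq\mathbb F_q^\times$ be a finite set of $\mathbb F_q$-rational places of $\mathbb P^1$ containing $0$ and $\infty$, let $\mathfrak o_{K,S}\subseteq K$ be the ring of rational functions without poles outside $S$, and set $$\Lambda_S=\mathcal A_{\mathfrak o_{K,S}}^\times/\mathfrak o_{K,S}^\times .$$ Write $[x]\in\Lambda_S$ for the class of $x\in\mathcal A_{\mathfrak o_{K,S}}^\times$. For $\tau\in S_0$ let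 $PA_\tau=\{[1+\alpha F] : \alpha\in\mathbb F_q[Z],\ N(\alpha)=\tau^{-1}\}\subseteq\Lambda_S$; here $1+\alpha F$ is indeed a unit of $\mathcal A_{\mathfrak o_{K,S}}$. Put $$\Gamma_S=\Big\langle \bigcup_{\tau\in S_0}PA_\tau\Big\rangle\subseteq\Lambda_S,\qquad \Gamma_S'=\big\langle aa' : a,a'\in PA_\tau,\ \tau\in S_0\big\rangle .$$ For $\alpha,\beta\in\mathbb F_q[Z]^\times$ with $N(\alpha)\neq N(\beta)$ put $\zeta_\alpha(\beta)=\dfrac{1+\alpha/\beta}{1+\bar\alpha/\bar\beta}$. For $\tau\in S_0$ let $K_\tau$ be the completion of $K$ at $t=\tau$, with valuation ring $\mathcal O_\tau$ and maximal ideal $\mathfrak m_\tau$, and let $T_\tau$ be the Bruhat–Tits tree of $\mathrm{PGL}_2(K_\tau)$: its vertices are the homothety classes of $\mathcal O_\tau$-lattices in $K_\tau^2$, and two vertices are adjacent if they have representatives $L,M$ with $\mathfrak m_\tau L\subsetneq M\subsetneq L$. The algebra $\mathcal A_{K_\tau}$ is isomorphic to $M_2(K_\tau)$; choose for every $\tau\in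 S_0$ any isomorphism of $K_\tau$-algebras between them. Then $\Lambda_S$ acts on the cube complex $T_{S_0}=\prod_{\tau\in S_0}T_\tau$, whose cells are the products of cells (vertices or edges) of the factors. **Theorem.** 1. The group $\Gamma_S'$ is a normal subgroup of $\Gamma_S$, and $\Gamma_S/\Gamma_S'\cong\{\pm1\}^{S_0}$. Moreover, $\Gamma_S'$ acts on $T_{S_0}$ without fixing a cell: no nontrivial element of $\Gamma'_S$ maps a cell of $T_{S_0}$ onto itself. In particular, $\Gamma_S'$ is torsion-free. 2. The group $\Gamma_S$ has the following presentation: it is generated by the elements $[1+\alpha F]$ with $N(\alpha)^{-1}\in S_0$, that is, by $\bigcup_{\tau\in S_0}PA_\tau$, subject to the relations (i) for all $\tau\in S_0$ and $[1+\alpha F]\in PA_\tau$, $$[1+\alpha F]^2=1;$$ (ii) for all $\tau\neq\sigma$ in $S_0$, $[1+\alpha F]\in PA_\tau$ and $[1+\beta F]\in PA_\sigma$, $$[1+\alpha F]\cdot[1+\beta F]=[1+\zeta_\alpha(\beta)\beta F]\cdot[1+\zeta_\beta(\alpha)\alpha F].$$ -/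

import Mathlib

open Polynomial IsDedekindDomain
open scoped Quaternion

noncomputable section

namespace QuatLattice

/-! ### The Bruhat–Tits tree of `PGL₂(E)` -/

section Tree

variable {E : Type*} [Field E] (O : ValuationSubring E)

/-- `O`-lattices in `E²`. -/
def Lat : Type _ := {L : Submodule O (Fin 2 → E) // Submodule.IsLattice E L}

/-- `GL₂(E)` acts on lattices by `L ↦ g(L)`. -/
def Lat.map (g : GL (Fin 2) E) (L : Lat O) : Lat O :=
  ⟨L.1.map ((Matrix.toLin' g.1).restrictScalars O), by
    obtain ⟨L, hL⟩ := L
    refine ⟨hL.fg.map _, ?_⟩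
    have h : (Submodule.map ((Matrix.toLin' g.1).restrictScalars O) L : Set (Fin 2 → E)) =
        (Matrix.toLin' g.1) '' (L : Set (Fin 2 → E)) := rfl
    rw [h, Submodule.span_image, hL.span_eq_top, Submodule.map_top, LinearMap.range_eq_top]
    intro y
    refine ⟨g.inv.mulVec y, ?_⟩
    rw [Matrix.toLin'_apply, Matrix.mulVec_mulVec, g.val_inv, Matrix.one_mulVec]⟩

/-- The scalar matrix `a` in `GL₂(E)`. -/
def scalarGL (a : Eˣ) : GL (Fin 2) E := Units.map (algebraMap E (Matrix (Fin 2) (Fin 2) E)) a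

lemma Lat.map_one (L : Lat O) : Lat.map O 1 L = L := by
  apply Subtype.ext
  ext x
  simp [Lat.map]

lemma Lat.map_mul (g h : GL (Fin 2) E) (L : Lat O) :
    Lat.map O (g * h) L = Lat.map O g (Lat.map O h L) := by
  apply Subtype.ext
  ext x
  simp [Lat.map]

lemma scalarGL_comm (a : Eˣ) (g : GL (Fin 2) E) : g * scalarGL a = scalarGL a * g := by
  apply Units.ext
  exact (Algebra.commutes (a : E) (g : Matrix (Fin 2) (Fin 2) E)).symm

/-- Two lattices are homothetic if they differ by a nonzero scalar. -/
def homothety : Setoid (Lat O) where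
  r L M := ∃ a : Eˣ, M = Lat.map O (scalarGL a) L
  iseqv :=
    { refl := fun L => ⟨1, by simp [scalarGL, Lat.map_one]⟩
      symm := by
        rintro L _ ⟨a, rfl⟩
        exact ⟨a⁻¹, by rw [← Lat.map_mul, scalarGL, scalarGL, ← _root_.map_mul]; simp [Lat.map_one]⟩
      trans := by
        rintro L _ _ ⟨a, rfl⟩ ⟨b, rfl⟩
        exact ⟨b * a, by rw [← Lat.map_mul, scalarGL, scalarGL, scalarGL, ← _root_.map_mul]⟩ }

/-- Vertices of the tree: homothety classes of lattices in `E²`. -/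
def Vertex : Type _ := Quotient (homothety O)

/-- The class of a lattice. -/
def Vertex.mk (L : Lat O) : Vertex O := Quotient.mk (homothety O) L

/-- The Bruhat–Tits tree (as a graph): `P` and `Q` are adjacent if they have representatives
`L` and `M` with `𝔪 L ⊊ M ⊊ L`, where `𝔪` is the maximal ideal of `O`. -/
def tree : SimpleGraph (Vertex O) :=
  SimpleGraph.fromRel fun P Q => ∃ L M : Lat O, Vertex.mk O L = P ∧ Vertex.mk O M = Q ∧
    IsLocalRing.maximalIdeal O • L.1 < M.1 ∧ M.1 < L.1

/-- `GL₂(E)` acts on the vertices of the tree. -/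
instance : MulAction (GL (Fin 2) E) (Vertex O) where
  smul g := Quotient.map (Lat.map O g) (by
    rintro L _ ⟨a, rfl⟩
    exact ⟨a, by rw [← Lat.map_mul, ← Lat.map_mul, scalarGL_comm]⟩)
  one_smul P := by
    induction P using Quotient.inductionOn with
    | h L => exact congrArg (Quotient.mk (homothety O)) (Lat.map_one O L)
  mul_smul g h P := by
    induction P using Quotient.inductionOn with
    | h L => exact congrArg (Quotient.mk (homothety O)) (Lat.map_mul O g h L)

lemma scalarGL_smul (a : Eˣ) (P : Vertex O) : scalarGL a • P = P := by
  induction P using Quotient.inductionOn with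
  | h L => exact (Quotient.sound (s := homothety O) ⟨a, rfl⟩).symm

/-- The cells of the tree (given by their sets of vertices): vertices and edges. -/
def IsTreeCell (C : Set (Vertex O)) : Prop :=
  (∃ P, C = {P}) ∨ ∃ P Q, (tree O).Adj P Q ∧ C = {P, Q}

end Tree

/-! ### The quaternion algebra and its order -/

section Order

variable {F : Type*} [Field F] (c : F)

/-- For an `F[t]`-algebra `R`, the quaternion algebra over `R` with basis `1, Z, F, ZF` and
`Z² = c + Z`, `F² = t`, `FZ = (1 - Z)F`; in characteristic two this is `Z² + Z = c`, `F² = t`,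
`FZ = (Z + 1)F`. -/
abbrev Quat (R : Type*) [CommRing R] [Algebra F[X] R] : Type _ :=
  ℍ[R, algebraMap F[X] R (C c), 1, algebraMap F[X] R X]

/-- Functoriality of `Quat` in the coefficients. -/
def Quat.map {R R' : Type*} [CommRing R] [CommRing R'] [Algebra F[X] R] [Algebra F[X] R']
    (f : R →ₐ[F[X]] R') : Quat c R →+* Quat c R' where
  toFun x := ⟨f x.re, f x.imI, f x.imJ, f x.imK⟩
  map_one' := by ext <;> simp
  map_zero' := by ext <;> simp
  map_add' x y := by ext <;> simp
  map_mul' x y := by ext <;> simp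

/-- The finite field `F[Z]`, where `Z² = c + Z` (that is, `Z² + Z = c` in characteristic two).
Mathlib's `QuadraticAlgebra.norm` and `star` are the norm to `F` and the conjugation. -/
abbrev FZ : Type _ := QuadraticAlgebra F c 1

/-- Irreducibility of `X² + X + c` makes `F[Z]` a field. -/
instance [CharP F 2] [h : Fact (Irreducible (X ^ 2 + X + C c : F[X]))] :
    Fact (∀ r : F, r ^ 2 ≠ c + 1 * r) := ⟨fun r hr => by
  have hdeg : (X ^ 2 + X + C c : F[X]).natDegree = 2 := by compute_degree!
  have hroot : (X ^ 2 + X + C c : F[X]).IsRoot r := by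
    simp only [IsRoot.def, eval_add, eval_pow, eval_X, eval_C]
    rw [hr]
    have := CharTwo.add_self_eq_zero (c + r)
    linear_combination this
  have hone : (X ^ 2 + X + C c : F[X]).natDegree = 1 :=
    natDegree_eq_of_degree_eq_some (degree_eq_one_of_irreducible_of_root h.out hroot)
  exact absurd (hdeg.symm.trans hone) (by decide)⟩

/-- The element `ζ_α(β) = (1 + α/β) / (1 + ᾱ/β̄)` of `F[Z]`. -/
def zeta [Fact (∀ r : F, r ^ 2 ≠ c + 1 * r)] (α β : FZ c) : FZ c :=
  (1 + α / β) / (1 + star α / star β)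

/-- The element `1 + αF` of the quaternion algebra over `R`, for `α = u + vZ` in `F[Z]`. -/
def oneAdd (R : Type*) [CommRing R] [Algebra F[X] R] (α : FZ c) : Quat c R :=
  ⟨1, 0, algebraMap F[X] R (C α.re), algebraMap F[X] R (C α.im)⟩

lemma oneAdd_mul (R : Type*) [CommRing R] [Algebra F[X] R] (α : FZ c) :
    oneAdd c R α * oneAdd c R (-α) = algebraMap R (Quat c R)
      (algebraMap F[X] R (1 - C (QuadraticAlgebra.norm α) * X)) := by
  ext <;> simp [oneAdd, QuadraticAlgebra.norm_def, QuaternionAlgebra.algebraMap_eq] <;> ring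

end Order

/-! ### The arithmetic group `Λ_S` and the subgroups `Γ_S`, `Γ'_S` -/

section Lattice

variable {F : Type*} [Field F]

/-- The place `t = a` of the rational function field `F(t)`. -/
def place (a : F) : HeightOneSpectrum F[X] where
  asIdeal := Ideal.span {X - C a}
  isPrime := (Ideal.span_singleton_prime (X_sub_C_ne_zero a)).2 (prime_X_sub_C a)
  ne_bot := by simpa using X_sub_C_ne_zero a

variable (c : F) (S₀ : Finset Fˣ)

/-- The finite places of `S = {0, ∞} ∪ S₀`. -/
def finPlaces : Set (HeightOneSpectrum F[X]) := {place 0} ∪ {v | ∃ τ ∈ S₀, v = place (τ : F)}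

/-- The ring of `S`-integers of `F(t)`, where `S = {0, ∞} ∪ S₀`: the rational functions with no
poles outside `S`. -/
abbrev SInt : Type _ := (finPlaces S₀).integer (RatFunc F)

/-- The group of units of the order `𝒜(𝔬_{K,S})`. -/
abbrev GLA : Type _ := (Quat c (SInt S₀))ˣ

/-- The subgroup `𝔬_{K,S}ˣ` of `𝒜(𝔬_{K,S})ˣ`. -/
def scalars : Subgroup (GLA c S₀) :=
  (Units.map (algebraMap (SInt S₀) (Quat c (SInt S₀)) : SInt S₀ →* Quat c (SInt S₀))).range

instance : (scalars c S₀).Normal where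
  conj_mem := by
    rintro _ ⟨a, rfl⟩ g
    refine ⟨a, ?_⟩
    rw [eq_mul_inv_iff_mul_eq]
    apply Units.ext
    exact Algebra.commutes (a : SInt S₀) (g : Quat c (SInt S₀))

/-- The `S`-arithmetic group `Λ_S = 𝒜(𝔬_{K,S})ˣ / 𝔬_{K,S}ˣ`. -/
abbrev Lam : Type _ := GLA c S₀ ⧸ scalars c S₀

/-- The elements `α` of `F[Z]` with `N(α)⁻¹ ∈ S₀`. -/
def Idx : Type _ := {α : FZ c // ∃ τ ∈ S₀, QuadraticAlgebra.norm α = (τ : F)⁻¹}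

lemma isUnit_one_sub {τ : Fˣ} (hτ : τ ∈ S₀) :
    IsUnit (algebraMap F[X] (SInt S₀) (1 - C (τ : F)⁻¹ * X)) := by
  have hτ0 : (τ : F) ≠ 0 := τ.ne_zero
  have hp : (1 - C (τ : F)⁻¹ * X : F[X]) ≠ 0 := by
    intro h
    have := congrArg (eval 0) h
    simp at this
  have hK : algebraMap F[X] (RatFunc F) (1 - C (τ : F)⁻¹ * X) ≠ 0 := by
    simpa using (map_ne_zero_iff _ (IsFractionRing.injective F[X] (RatFunc F))).2 hp
  have hmem : (algebraMap F[X] (RatFunc F) (1 - C (τ : F)⁻¹ * X))⁻¹ ∈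
      (finPlaces S₀).integer (RatFunc F) := by
    intro v hv
    rw [map_inv₀]
    have h1 : v.valuation (RatFunc F) (algebraMap F[X] (RatFunc F) (1 - C (τ : F)⁻¹ * X)) = 1 := by
      refine le_antisymm (v.valuation_le_one _) (not_lt.1 fun hlt => hv (Or.inr ⟨τ, hτ, ?_⟩))
      rw [HeightOneSpectrum.valuation_lt_one_iff_mem] at hlt
      have hmem : (X - C (τ : F) : F[X]) ∈ v.asIdeal := by
        have h2 : (X - C (τ : F) : F[X]) = (-C (τ : F)) * (1 - C (τ : F)⁻¹ * X) := by
          have h3 : (C (τ : F) * C (τ : F)⁻¹ : F[X]) = 1 := by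
            rw [← C_mul, mul_inv_cancel₀ hτ0, C_1]
          linear_combination (-X) * h3
        rw [h2]
        exact v.asIdeal.mul_mem_left _ hlt
      apply HeightOneSpectrum.ext
      have hmax : (place (τ : F)).asIdeal.IsMaximal := (place (τ : F)).isMaximal
      refine (hmax.eq_of_le v.isPrime.ne_top ?_).symm
      exact (Ideal.span_singleton_le_iff_mem _).2 hmem
    rw [h1, inv_one]
  refine IsUnit.of_mul_eq_one ⟨_, hmem⟩ ?_
  apply Subtype.ext
  exact mul_inv_cancel₀ hK

lemma isUnit_oneAdd (α : Idx c S₀) : IsUnit (oneAdd c (SInt S₀) α.1) := by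
  obtain ⟨α, τ, hτ, hα⟩ := α
  have hu := (isUnit_one_sub S₀ hτ).map (algebraMap (SInt S₀) (Quat c (SInt S₀)))
  have h1 := oneAdd_mul c (SInt S₀) α
  have h2 := oneAdd_mul c (SInt S₀) (-α)
  rw [hα] at h1
  rw [QuadraticAlgebra.norm_neg, neg_neg, hα] at h2
  have hl : IsUnit (oneAdd c (SInt S₀) α * oneAdd c (SInt S₀) (-α)) := h1 ▸ hu
  have hr : IsUnit (oneAdd c (SInt S₀) (-α) * oneAdd c (SInt S₀) α) := h2 ▸ hu
  obtain ⟨u, hu⟩ := hl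
  obtain ⟨w, hw⟩ := hr
  refine isUnit_iff_exists_and_exists.2
    ⟨⟨oneAdd c (SInt S₀) (-α) * ↑u⁻¹, ?_⟩, ⟨↑w⁻¹ * oneAdd c (SInt S₀) (-α), ?_⟩⟩
  · rw [← mul_assoc, ← hu, Units.mul_inv]
  · rw [mul_assoc, ← hw, Units.inv_mul]

/-- The class `[1 + αF]` in `Λ_S`. -/
def gen (α : Idx c S₀) : Lam c S₀ := QuotientGroup.mk (isUnit_oneAdd c S₀ α).unit

/-- For `τ ∈ S₀`, the set `PA_τ` of all `[1 + αF]` with `N(α) = τ⁻¹`. -/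
def PA (τ : Fˣ) : Set (Lam c S₀) :=
  {a | ∃ α : Idx c S₀, QuadraticAlgebra.norm α.1 = (τ : F)⁻¹ ∧ a = gen c S₀ α}

/-- `Γ_S`, the subgroup of `Λ_S` generated by `⋃_{τ ∈ S₀} PA_τ`. -/
def Gam : Subgroup (Lam c S₀) := Subgroup.closure (⋃ τ ∈ S₀, PA c S₀ τ)

/-- `Γ'_S`, the subgroup generated by the products `a a'` with `a, a' ∈ PA_τ`, `τ ∈ S₀`. -/
def Gam' : Subgroup (Lam c S₀) :=
  Subgroup.closure {g | ∃ τ ∈ S₀, ∃ a ∈ PA c S₀ τ, ∃ a' ∈ PA c S₀ τ, g = a * a'}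

/-- The relators of the presentation of `Γ_S` for even `q`, on symbols `x_α` that stand for
`[1 + αF]`: `x_α²` for all `α`, and, whenever `N(α) ≠ N(β)`, the relator of
`x_α x_β = x_γ x_δ` with `γ = ζ_α(β)β` and `δ = ζ_β(α)α`. -/
def rels [Fact (∀ r : F, r ^ 2 ≠ c + 1 * r)] : Set (FreeGroup (Idx c S₀)) :=
  {r | ∃ α : Idx c S₀, r = FreeGroup.of α ^ 2} ∪
  {r | ∃ α β γ δ : Idx c S₀, QuadraticAlgebra.norm α.1 ≠ QuadraticAlgebra.norm β.1 ∧
    γ.1 = zeta c α.1 β.1 * β.1 ∧ δ.1 = zeta c β.1 α.1 * α.1 ∧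
    r = FreeGroup.of α * FreeGroup.of β * (FreeGroup.of γ * FreeGroup.of δ)⁻¹}

/-! ### The action on the product of trees -/

/-- The completion `K_τ` of `K = F(t)` at `t = τ`. -/
abbrev Kv (τ : Fˣ) : Type _ := (place (τ : F)).adicCompletion (RatFunc F)

/-- The valuation ring of `K_τ`. -/
abbrev Ov (τ : Fˣ) : ValuationSubring (Kv τ) :=
  (place (τ : F)).adicCompletionIntegers (RatFunc F)

/-- An identification of `D ⊗ K_τ`, the quaternion algebra over `K_τ`, with `M₂(K_τ)`. -/
abbrev Splitting (τ : Fˣ) : Type _ := Quat c (Kv τ) ≃ₐ[Kv τ] Matrix (Fin 2) (Fin 2) (Kv τ)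

/-- The inclusion of the `S`-integers into `K_τ`. -/
def toKv (τ : Fˣ) : SInt S₀ →ₐ[F[X]] Kv τ :=
  (IsScalarTower.toAlgHom F[X] (RatFunc F) (Kv τ)).comp
    (((finPlaces S₀).integer (RatFunc F)).val)

variable {c}

/-- The localisation `𝒜(𝔬_{K,S})ˣ → GL₂(K_τ)` at `τ`. -/
def toGL {τ : Fˣ} (φ : Splitting c τ) : GLA c S₀ →* GL (Fin 2) (Kv τ) :=
  Units.map (((φ : Quat c (Kv τ) →+* Matrix (Fin 2) (Fin 2) (Kv τ)).comp
    (Quat.map c (toKv S₀ τ)) : Quat c (SInt S₀) →* Matrix (Fin 2) (Fin 2) (Kv τ)))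

/-- The vertices of the product of trees `∏_{τ ∈ S₀} T_τ`. -/
abbrev PT : Type _ := ∀ τ : S₀, Vertex (Ov (τ : Fˣ))

/-- The cells of the cube complex `∏_{τ ∈ S₀} T_τ` (given by their sets of vertices): products of
cells of the factors. -/
def IsCell (C : Set (PT S₀)) : Prop :=
  ∃ D : ∀ τ : S₀, Set (Vertex (Ov (τ : Fˣ))),
    (∀ τ : S₀, IsTreeCell (Ov (τ : Fˣ)) (D τ)) ∧ C = Set.univ.pi D

/-- The diagonal action of `𝒜(𝔬_{K,S})ˣ` on the product of trees. -/
def actGLA (φ : ∀ τ : S₀, Splitting c (τ : Fˣ)) : GLA c S₀ →* Equiv.Perm (PT S₀) where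
  toFun g :=
    { toFun := fun P τ => toGL S₀ (φ τ) g • P τ
      invFun := fun P τ => (toGL S₀ (φ τ) g)⁻¹ • P τ
      left_inv := fun P => funext fun τ => inv_smul_smul _ _
      right_inv := fun P => funext fun τ => smul_inv_smul _ _ }
  map_one' := by ext P τ; simp
  map_mul' g h := by ext P τ; simp [mul_smul]

lemma toGL_scalar {τ : Fˣ} (φ : Splitting c τ) (a : (SInt S₀)ˣ) :
    toGL S₀ φ (Units.map (algebraMap (SInt S₀) (Quat c (SInt S₀)) :
      SInt S₀ →* Quat c (SInt S₀)) a) =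
    scalarGL (Units.map (toKv S₀ τ : SInt S₀ →* Kv τ) a) := by
  apply Units.ext
  have h : Quat.map c (toKv S₀ τ) (algebraMap (SInt S₀) (Quat c (SInt S₀)) (a : SInt S₀)) =
      algebraMap (Kv τ) (Quat c (Kv τ)) (toKv S₀ τ a) := by
    ext <;> simp [Quat.map, QuaternionAlgebra.algebraMap_eq]
  change φ (Quat.map c (toKv S₀ τ) (algebraMap (SInt S₀) (Quat c (SInt S₀)) (a : SInt S₀))) =
    algebraMap (Kv τ) (Matrix (Fin 2) (Fin 2) (Kv τ)) (toKv S₀ τ a)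
  rw [h]
  exact φ.commutes _

/-- The action of `Λ_S` on the product of trees. -/
def act (φ : ∀ τ : S₀, Splitting c (τ : Fˣ)) : Lam c S₀ →* Equiv.Perm (PT S₀) :=
  QuotientGroup.lift (scalars c S₀) (actGLA S₀ φ) (by
    rintro _ ⟨a, rfl⟩
    ext P τ
    exact congrFun (funext fun τ => by
      change toGL S₀ (φ τ) _ • P τ = P τ
      rw [toGL_scalar, scalarGL_smul]) τ)

end Lattice

end QuatLattice

end

/-! A word in the letters `1 + αF` is studied by specialising `t` to `b = τ`. The reduced norm of a
letter becomes `1 - b N(α)`, so the letters belonging to `τ` become zero divisors, while all others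
stay invertible. A nonempty product of degenerate letters without equal neighbours does not vanish:
it is a nonzero left `F[Z]`-multiple of its last letter (`exists_prod_oneAddAt`). A scalar word
containing degenerate letters would have to vanish at `τ`, since its reduced norm is a square that
vanishes there. Hence a word with a nonempty reduced block at `τ` is nontrivial in `Λ_S`
(`wordUnit_append_notMem_scalars`).

The exchange relation (ii) moves all letters of one norm to the end of a word. The resulting block
is either reduced, and the word is nontrivial, or it contains a square that relation (i) removes.
Induction on the length gives the presentation (`presHom_injective`). Both relations preserve the
parity of the number of letters at each place, so `signHom` is defined on the presented group; its
kernel consists of the classes of even words, which form `Γ'_S`.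

For the action, an element with `|trd|² > |nrd|` at `τ` is hyperbolic: it fixes no vertex of `T_τ`,
and neither do its nonzero powers, so it preserves no edge and has infinite order. A nontrivial
element of `Γ'_S` is hyperbolic at some `τ` (`EvenWord.eq_one_or_isHypClass`). Indeed, the reduced
norm of a word with a nonempty reduced block at `τ` vanishes at `τ`. If its reduced trace does not,
the word is hyperbolic. If the trace vanishes too, conjugating by the last letter produces a
cancellation, and the result is a shorter even word, to which induction applies. -/

noncomputable section

namespace QuatLattice

/-! ### Reduced trace and norm -/

section ReducedNorm

variable {R : Type*} [CommRing R] {a b : R}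

/-- The reduced trace of the quaternion algebra with `Z² = a + Z`, `F² = b`. -/
def trd (x : ℍ[R,a,1,b]) : R := 2 * x.re + x.imI

/-- The reduced norm of the quaternion algebra with `Z² = a + Z`, `F² = b`. -/
def nrd (x : ℍ[R,a,1,b]) : R :=
  x.re ^ 2 + x.re * x.imI - a * x.imI ^ 2 - b * (x.imJ ^ 2 + x.imJ * x.imK - a * x.imK ^ 2)

lemma nrd_mul (x y : ℍ[R,a,1,b]) : nrd (x * y) = nrd x * nrd y := by
  simp [nrd]; ring

lemma nrd_one : nrd (1 : ℍ[R,a,1,b]) = 1 := by simp [nrd]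

lemma trd_mul_comm (x y : ℍ[R,a,1,b]) : trd (x * y) = trd (y * x) := by
  simp [trd]; ring

lemma star_mul_self_eq (x : ℍ[R,a,1,b]) : star x * x = algebraMap R _ (nrd x) := by
  ext <;> simp [nrd, QuaternionAlgebra.algebraMap_eq] <;> ring

lemma sq_eq_trd_sub_nrd (x : ℍ[R,a,1,b]) :
    x * x = algebraMap R _ (trd x) * x - algebraMap R _ (nrd x) := by
  ext <;> simp [nrd, trd, QuaternionAlgebra.algebraMap_eq] <;> ring

lemma trd_algebraMap_mul (r : R) (x : ℍ[R,a,1,b]) :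
    trd (algebraMap R _ r * x) = r * trd x := by
  simp [trd, QuaternionAlgebra.algebraMap_eq]; ring

lemma nrd_algebraMap (r : R) : nrd (algebraMap R ℍ[R,a,1,b] r) = r ^ 2 := by
  simp [nrd, QuaternionAlgebra.algebraMap_eq]

lemma trd_algebraMap (r : R) : trd (algebraMap R ℍ[R,a,1,b] r) = 2 * r := by
  simp [trd, QuaternionAlgebra.algebraMap_eq]

lemma trd_sub (x y : ℍ[R,a,1,b]) : trd (x - y) = trd x - trd y := by
  simp [trd]; ring

/-- Cayley–Hamilton multiplied by `x ^ n`; the recursion controls the traces of powers of hyperbolic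
elements. -/
lemma trd_pow_add_two (x : ℍ[R,a,1,b]) (n : ℕ) :
    trd (x ^ (n + 2)) = trd x * trd (x ^ (n + 1)) - nrd x * trd (x ^ n) := by
  have h : x ^ (n + 2) = algebraMap R _ (trd x) * x ^ (n + 1) - algebraMap R _ (nrd x) * x ^ n := by
    rw [pow_add, pow_two, sq_eq_trd_sub_nrd, mul_sub, pow_succ, ← Algebra.commutes (nrd x),
      ← mul_assoc, ← Algebra.commutes (trd x), mul_assoc]
  rw [h, trd_sub, trd_algebraMap_mul, trd_algebraMap_mul]

lemma nrd_pow (x : ℍ[R,a,1,b]) (n : ℕ) : nrd (x ^ n) = nrd x ^ n := by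
  induction n with
  | zero => simp [nrd_one]
  | succ n ih => rw [pow_succ, nrd_mul, ih, pow_succ]

end ReducedNorm

/-- Up to the scalar `nrd u`, `star u` is a left inverse of `u`. This strips the nondegenerate
letters from the front of a vanishing word. -/
lemma eq_zero_of_mul_eq_zero_of_nrd_ne_zero {K : Type*} [Field K] {a b : K} {u x : ℍ[K,a,1,b]}
    (hu : nrd u ≠ 0) (h : u * x = 0) : x = 0 := by
  have h1 : algebraMap K _ (nrd u) * x = 0 := by
    rw [← star_mul_self_eq, mul_assoc, h, mul_zero]
  have h2 : algebraMap K ℍ[K,a,1,b] (nrd u)⁻¹ * (algebraMap K _ (nrd u) * x) = x := by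
    rw [← mul_assoc, ← map_mul, inv_mul_cancel₀ hu, map_one, one_mul]
  rw [← h2, h1, mul_zero]

/-! ### Words at a degenerate place -/

section Residue

variable {F : Type*} [Field F] {c : F}

/-- The inclusion of `F[Z]` in the quaternion algebra. -/
def ofFZ (b : F) (μ : FZ c) : ℍ[F,c,1,b] := ⟨μ.re, μ.im, 0, 0⟩

/-- The element `1 + αF` of the quaternion algebra over `F` with `F² = b`. -/
def oneAddAt (b : F) (α : FZ c) : ℍ[F,c,1,b] := ⟨1, 0, α.re, α.im⟩

lemma ofFZ_mul (b : F) (μ ν : FZ c) : ofFZ b (μ * ν) = ofFZ b μ * ofFZ b ν := by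
  ext <;> simp [ofFZ]

lemma ofFZ_one (b : F) : ofFZ b (1 : FZ c) = 1 := by
  ext <;> simp [ofFZ, QuadraticAlgebra.re_one, QuadraticAlgebra.im_one]

lemma nrd_oneAddAt (b : F) (α : FZ c) :
    nrd (oneAddAt b α) = 1 - b * QuadraticAlgebra.norm α := by
  simp only [nrd, oneAddAt, QuadraticAlgebra.norm_def]; ring

lemma ofFZ_mul_oneAddAt_ne_zero (b : F) {μ : FZ c} (hμ : μ ≠ 0) (α : FZ c) :
    ofFZ b μ * oneAddAt b α ≠ 0 := by
  intro h
  apply hμ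
  have h1 := congrArg QuaternionAlgebra.re h
  have h2 := congrArg QuaternionAlgebra.imI h
  simp [ofFZ, oneAddAt] at h1 h2
  ext <;> simp [h1, h2]

variable [CharP F 2]

/-- If `b N(α) = 1`, the left ideal generated by `1 + αF` is spanned by it over `F[Z]`. -/
lemma mul_oneAddAt {b : F} {α : FZ c} (hα : b * QuadraticAlgebra.norm α = 1) (x : ℍ[F,c,1,b]) :
    x * oneAddAt b α =
      ofFZ b (⟨x.re, x.imI⟩ + b • (⟨x.imJ, x.imK⟩ * star α)) * oneAddAt b α := by
  have h2 : (2 : F) = 0 := CharTwo.two_eq_zero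
  rw [QuadraticAlgebra.norm_def] at hα
  ext
  · simp [oneAddAt, ofFZ]; ring
  · simp [oneAddAt, ofFZ]; ring
  · simp [oneAddAt, ofFZ]; linear_combination -x.imJ * hα
  · simp [oneAddAt, ofFZ]; linear_combination -x.imK * hα

/-- In characteristic two the trace is the `Z`-coordinate of `ν`, so its vanishing makes `ν` a
central scalar, and `(1 + αF)² = 1 - b N(α) = 0`. -/
lemma oneAddAt_mul_of_trd {b : F} {α : FZ c} (hα : b * QuadraticAlgebra.norm α = 1) (ν : FZ c)
    (h : trd (ofFZ b ν * oneAddAt b α) = 0) :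
    oneAddAt b α * (ofFZ b ν * oneAddAt b α) = 0 := by
  have h2 : (2 : F) = 0 := CharTwo.two_eq_zero
  rw [QuadraticAlgebra.norm_def] at hα
  have him : ν.im = 0 := by
    simp [trd, ofFZ, oneAddAt] at h
    linear_combination h - ν.re * h2
  ext
  · simp [oneAddAt, ofFZ, him]; linear_combination ν.re * h2 + ν.re * hα
  · simp [oneAddAt, ofFZ, him]; ring
  · simp [oneAddAt, ofFZ, him]; linear_combination ν.re * α.re * h2
  · simp [oneAddAt, ofFZ, him]; linear_combination ν.re * α.im * h2

variable [Fact (∀ r : F, r ^ 2 ≠ c + 1 * r)]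

/-- The new factor is `1 + bαβ̄`. Since `bβ̄ = β⁻¹`, it equals `1 + α/β`, which vanishes in
characteristic two only for `α = β`. -/
lemma ofFZ_mul_oneAddAt_mul {b : F} {α β : FZ c}
    (hβ : b * QuadraticAlgebra.norm β = 1) (hne : α ≠ β) {μ : FZ c} (hμ : μ ≠ 0) :
    ∃ ν : FZ c, ν ≠ 0 ∧
      ofFZ b μ * oneAddAt b α * oneAddAt b β = ofFZ b ν * oneAddAt b β := by
  refine ⟨μ * (1 + b • (α * star β)), mul_ne_zero hμ fun h => hne ?_, ?_⟩
  · have h3 : algebraMap F (FZ c) b * (β * star β) = 1 := by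
      rw [← QuadraticAlgebra.algebraMap_norm_eq_mul_star, ← map_mul, hβ, map_one]
    rw [Algebra.smul_def] at h
    have h4 : β + α = 0 := by linear_combination β * h - α * h3
    have h5 : (2 : FZ c) = 0 := by
      rw [← map_ofNat (algebraMap F (FZ c)) 2, CharTwo.two_eq_zero, map_zero]
    linear_combination h4 - β * h5
  · rw [mul_assoc, mul_oneAddAt hβ (oneAddAt b α), ← mul_assoc, ← ofFZ_mul]
    rfl

/-- A reduced word of letters `1 + αF` with `b N(α) = 1` is a nonzero `F[Z]`-multiple of its last
letter. -/
lemma exists_prod_oneAddAt {b : F} (l : List (FZ c))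
    (hl : ∀ β ∈ l, b * QuadraticAlgebra.norm β = 1) (hr : l.IsChain (· ≠ ·)) (hne : l ≠ []) :
    ∃ μ : FZ c, μ ≠ 0 ∧
      (l.map (oneAddAt b)).prod = ofFZ b μ * oneAddAt b (l.getLast hne) := by
  induction l using List.reverseRecOn with
  | nil => exact absurd rfl hne
  | append_singleton l β ih =>
    rcases List.eq_nil_or_concat l with rfl | ⟨l', α, rfl⟩
    · exact ⟨1, one_ne_zero, by simp [ofFZ_one]⟩
    · have hr' := List.isChain_append.1 hr
      obtain ⟨μ, hμ, h⟩ := ih (fun β hβ => hl β (by simp at hβ ⊢; tauto)) hr'.1 (by simp)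
      have hαβ : α ≠ β := hr'.2.2 α (by simp) β (by simp)
      obtain ⟨ν, hν, h'⟩ := ofFZ_mul_oneAddAt_mul (hl β (by simp)) hαβ hμ
      refine ⟨ν, hν, ?_⟩
      rw [List.map_append, List.prod_append, h]
      simpa using h'

lemma prod_oneAddAt_ne_zero {b : F} (l : List (FZ c))
    (hl : ∀ β ∈ l, b * QuadraticAlgebra.norm β = 1) (hr : l.IsChain (· ≠ ·)) :
    (l.map (oneAddAt b)).prod ≠ 0 := by
  rcases eq_or_ne l [] with rfl | hne
  · simp
  · obtain ⟨μ, hμ, h⟩ := exists_prod_oneAddAt l hl hr hne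
    rw [h]
    exact ofFZ_mul_oneAddAt_ne_zero b hμ _

end Residue

/-! ### Reduction at a rational point -/

section Reduction

variable {F : Type*} [Field F] (c : F)

/-- Reduction of the quaternion algebra over `F[t]` at `t = b`. -/
def evalQuat (b : F) : Quat c F[X] →+* ℍ[F,c,1,b] where
  toFun x := ⟨x.re.eval b, x.imI.eval b, x.imJ.eval b, x.imK.eval b⟩
  map_one' := by ext <;> simp
  map_zero' := by ext <;> simp
  map_add' x y := by ext <;> simp
  map_mul' x y := by ext <;> simp

lemma evalQuat_oneAdd (b : F) (α : FZ c) : evalQuat c b (oneAdd c F[X] α) = oneAddAt b α := by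
  ext <;> simp [evalQuat, oneAdd, oneAddAt]

lemma nrd_evalQuat (b : F) (x : Quat c F[X]) : nrd (evalQuat c b x) = (nrd x).eval b := by
  simp [nrd, evalQuat]

lemma trd_evalQuat (b : F) (x : Quat c F[X]) : trd (evalQuat c b x) = (trd x).eval b := by
  simp [trd, evalQuat]

variable {R R' : Type*} [CommRing R] [CommRing R'] [Algebra F[X] R] [Algebra F[X] R']
  (f : R →ₐ[F[X]] R')

lemma nrd_map (x : Quat c R) : nrd (Quat.map c f x) = f (nrd x) := by
  simp [nrd, Quat.map]

lemma trd_map (x : Quat c R) : trd (Quat.map c f x) = f (trd x) := by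
  simp [trd, Quat.map, map_ofNat f 2]

lemma map_oneAdd (α : FZ c) : Quat.map c f (oneAdd c R α) = oneAdd c R' α := by
  ext <;> simp [Quat.map, oneAdd]

lemma map_algebraMap (r : R) :
    Quat.map c f (algebraMap R (Quat c R) r) = algebraMap R' (Quat c R') (f r) := by
  ext <;> simp [Quat.map, QuaternionAlgebra.algebraMap_eq]

end Reduction

/-! ### Words in the generators -/

section Words

variable {F : Type*} [Field F] {c : F}

lemma oneAdd_mul_oneAdd (R : Type*) [CommRing R] [Algebra F[X] R] (α β : FZ c) :
    oneAdd c R α * oneAdd c R β =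
      ⟨algebraMap F[X] R (1 + X * C (α * star β).re), algebraMap F[X] R (X * C (α * star β).im),
        algebraMap F[X] R (C (α + β).re), algebraMap F[X] R (C (α + β).im)⟩ := by
  ext <;> simp [oneAdd] <;> ring

lemma oneAdd_sq [CharP F 2] (R : Type*) [CommRing R] [Algebra F[X] R] (α : FZ c) :
    oneAdd c R α * oneAdd c R α = algebraMap R (Quat c R)
      (algebraMap F[X] R (1 - C (QuadraticAlgebra.norm α) * X)) := by
  have h : -α = α := by ext <;> simp [CharTwo.neg_eq]
  have := oneAdd_mul c R α
  rwa [h] at this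

variable (c) (S₀ : Finset Fˣ)

/-- The product in the quaternion algebra over `F[t]` of a word in the letters `1 + αF`. -/
def wordQuat {c : F} {S₀ : Finset Fˣ} (l : List (Idx c S₀)) : Quat c F[X] :=
  (l.map fun α => oneAdd c F[X] α.1).prod

/-- The product in `𝒜(𝔬_{K,S})ˣ` of a word in the letters `1 + αF`. -/
def wordUnit {c : F} {S₀ : Finset Fˣ} (l : List (Idx c S₀)) : GLA c S₀ :=
  (l.map fun α => (isUnit_oneAdd c S₀ α).unit).prod

lemma wordUnit_val (l : List (Idx c S₀)) :
    (wordUnit l : Quat c (SInt S₀)) = Quat.map c (Algebra.ofId F[X] (SInt S₀)) (wordQuat l) := by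
  induction l with
  | nil => simp [wordUnit, wordQuat]
  | cons a l ih =>
    simp only [wordUnit, wordQuat, List.map_cons, List.prod_cons, Units.val_mul, map_mul] at ih ⊢
    rw [ih, map_oneAdd]
    rfl

lemma prod_gen (l : List (Idx c S₀)) :
    (l.map (gen c S₀)).prod = QuotientGroup.mk (wordUnit l) := by
  induction l with
  | nil => rfl
  | cons a l ih => rw [List.map_cons, List.prod_cons, ih]; rfl

/-- The element `α` of `F[Z]` underlying the letter `1 + αF`. -/
def Idx.toFZ {c : F} {S₀ : Finset Fˣ} (α : Idx c S₀) : FZ c := α.1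

lemma Idx.toFZ_injective : Function.Injective (Idx.toFZ : Idx c S₀ → FZ c) :=
  Subtype.val_injective

lemma evalQuat_wordQuat (b : F) (l : List (Idx c S₀)) :
    evalQuat c b (wordQuat l) = ((l.map Idx.toFZ).map (oneAddAt b)).prod := by
  rw [wordQuat, map_list_prod, List.map_map, List.map_map]
  congr 1
  exact List.map_congr_left fun α _ => evalQuat_oneAdd c b α.1

lemma wordQuat_append (l l' : List (Idx c S₀)) :
    wordQuat (l ++ l') = wordQuat l * wordQuat l' := by
  simp [wordQuat]

variable {c S₀}

lemma norm_ne_zero (α : Idx c S₀) : QuadraticAlgebra.norm α.1 ≠ 0 := by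
  obtain ⟨α, τ, -, h⟩ := α
  simp [h]

lemma val_ne_zero (α : Idx c S₀) : α.1 ≠ 0 := fun h =>
  norm_ne_zero α (by rw [h, QuadraticAlgebra.norm_zero])

lemma add_ne_zero_of_norm_ne {α β : FZ c}
    (h : QuadraticAlgebra.norm α ≠ QuadraticAlgebra.norm β) : α + β ≠ 0 := fun h0 =>
  h (by rw [eq_neg_of_add_eq_zero_left h0, QuadraticAlgebra.norm_neg])

lemma nrd_evalQuat_wordQuat_ne_zero {b : F} {l : List (Idx c S₀)}
    (hl : ∀ α ∈ l, QuadraticAlgebra.norm α.1 ≠ b⁻¹) :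
    nrd (evalQuat c b (wordQuat l)) ≠ 0 := by
  induction l with
  | nil => simp [wordQuat, nrd_one]
  | cons a l ih =>
    rw [show a :: l = [a] ++ l from rfl, wordQuat_append, map_mul, nrd_mul]
    refine mul_ne_zero ?_ (ih fun α hα => hl α (by simp [hα]))
    have : wordQuat [a] = oneAdd c F[X] a.1 := by simp [wordQuat]
    rw [this, evalQuat_oneAdd, nrd_oneAddAt]
    intro h
    exact hl a (by simp) (eq_inv_of_mul_eq_one_right (sub_eq_zero.1 h).symm)

lemma nrd_evalQuat_wordQuat_eq_zero {b : F} {l : List (Idx c S₀)}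
    (hl : ∀ α ∈ l, QuadraticAlgebra.norm α.1 = b⁻¹) (hb : b ≠ 0) (hne : l ≠ []) :
    nrd (evalQuat c b (wordQuat l)) = 0 := by
  obtain ⟨a, l, rfl⟩ := List.exists_cons_of_ne_nil hne
  have : wordQuat [a] = oneAdd c F[X] a.1 := by simp [wordQuat]
  rw [show a :: l = [a] ++ l from rfl, wordQuat_append, map_mul, nrd_mul, this, evalQuat_oneAdd,
    nrd_oneAddAt, hl a (by simp), mul_inv_cancel₀ hb, sub_self, zero_mul]

variable [CharP F 2] [Fact (Irreducible (X ^ 2 + X + C c : F[X]))]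

lemma evalQuat_wordQuat_ne_zero {b : F} {l : List (Idx c S₀)}
    (hl : ∀ α ∈ l, QuadraticAlgebra.norm α.1 = b⁻¹) (hb : b ≠ 0) (hr : l.IsChain (· ≠ ·)) :
    evalQuat c b (wordQuat l) ≠ 0 := by
  rw [evalQuat_wordQuat]
  refine prod_oneAddAt_ne_zero _ ?_ ?_
  · intro β hβ
    obtain ⟨α, hα, rfl⟩ := List.mem_map.1 hβ
    rw [Idx.toFZ, hl α hα, mul_inv_cancel₀ hb]
  · rw [List.isChain_map]
    exact hr.imp fun x y hxy h => hxy (Idx.toFZ_injective c S₀ h)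

/-- A word that is reduced and nonempty at one place is not trivial in `Λ_S`. -/
lemma wordUnit_append_notMem_scalars {b : F} {l₁ l₂ : List (Idx c S₀)} (hb : b ≠ 0)
    (h₁ : ∀ α ∈ l₁, QuadraticAlgebra.norm α.1 ≠ b⁻¹)
    (h₂ : ∀ α ∈ l₂, QuadraticAlgebra.norm α.1 = b⁻¹)
    (hne : l₂ ≠ []) (hr : l₂.IsChain (· ≠ ·)) : wordUnit (l₁ ++ l₂) ∉ scalars c S₀ := by
  rintro ⟨s, hs⟩
  have hs' := congrArg Units.val hs
  rw [wordUnit_val] at hs'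
  have hinj : Function.Injective (algebraMap F[X] (SInt S₀)) := fun x y h =>
    IsFractionRing.injective F[X] (RatFunc F) (congrArg Subtype.val h)
  have hz : ∀ p : F[X], Algebra.ofId F[X] (SInt S₀) p = 0 → p = 0 := fun p hp =>
    (map_eq_zero_iff _ hinj).1 hp
  obtain ⟨p, hp⟩ : ∃ p, wordQuat (l₁ ++ l₂) = algebraMap F[X] (Quat c F[X]) p := by
    refine ⟨(wordQuat (l₁ ++ l₂)).re, ?_⟩
    apply QuaternionAlgebra.ext
    · simp [QuaternionAlgebra.algebraMap_eq]
    · exact hz _ (congrArg QuaternionAlgebra.imI hs').symm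
    · exact hz _ (congrArg QuaternionAlgebra.imJ hs').symm
    · exact hz _ (congrArg QuaternionAlgebra.imK hs').symm
  -- The degenerate block makes the reduced norm `p²` vanish at `b`.
  have h0 : p.eval b = 0 := by
    have h1 : nrd (evalQuat c b (wordQuat (l₁ ++ l₂))) = 0 := by
      rw [wordQuat_append, map_mul, nrd_mul, nrd_evalQuat_wordQuat_eq_zero h₂ hb hne, mul_zero]
    rw [nrd_evalQuat, hp, nrd_algebraMap, eval_pow] at h1
    exact pow_eq_zero_iff two_ne_zero |>.1 h1
  -- The whole word now vanishes at `b`; as `l₁` is invertible there, the reduced block `l₂` would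
  -- vanish as well.
  refine evalQuat_wordQuat_ne_zero h₂ hb hr
    (eq_zero_of_mul_eq_zero_of_nrd_ne_zero (nrd_evalQuat_wordQuat_ne_zero h₁) ?_)
  rw [← map_mul, ← wordQuat_append, hp]
  ext <;> simp [evalQuat, QuaternionAlgebra.algebraMap_eq, h0]

/-! ### The commutation relations -/

/-- In this form the new letter is `β̄` times the quotient of `α + β` by its conjugate, an element
of norm one. -/
lemma zeta_mul {α β : FZ c} (hβ : β ≠ 0) (h : α + β ≠ 0) :
    zeta c α β * β = (α + β) * star β / (star α + star β) := by
  have hβ' : star β ≠ 0 := (star_ne_zero).2 hβ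
  have h' : star α + star β ≠ 0 := by rw [← star_add]; exact star_ne_zero.2 h
  have e1 : 1 + α / β = (α + β) / β := by field_simp; ring
  have e2 : 1 + star α / star β = (star α + star β) / star β := by field_simp; ring
  rw [zeta, e1, e2]
  field_simp

lemma norm_zeta_mul {α β : FZ c} (hβ : β ≠ 0) (h : α + β ≠ 0) :
    QuadraticAlgebra.norm (zeta c α β * β) = QuadraticAlgebra.norm β := by
  have h' : star α + star β ≠ 0 := by rw [← star_add]; exact star_ne_zero.2 h
  have h1 : zeta c α β * β * star (α + β) = (α + β) * star β := by
    rw [zeta_mul hβ h, star_add, div_mul_cancel₀ _ h']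
  have h2 := congrArg QuadraticAlgebra.norm h1
  rw [map_mul, map_mul (f := QuadraticAlgebra.norm) (α + β), QuadraticAlgebra.norm_star,
    QuadraticAlgebra.norm_star, mul_comm] at h2
  exact mul_left_cancel₀ (mt QuadraticAlgebra.norm_eq_zero_iff_eq_zero.1 h) h2

/-- A product of two letters depends only on `α + β` and `αβ̄`, and the exchanged pair has the same
two invariants. -/
lemma oneAdd_mul_oneAdd_eq (R : Type*) [CommRing R] [Algebra F[X] R] {α β : FZ c} (hα : α ≠ 0)
    (hβ : β ≠ 0) (h : α + β ≠ 0) : oneAdd c R α * oneAdd c R β =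
      oneAdd c R (zeta c α β * β) * oneAdd c R (zeta c β α * α) := by
  have h' : star α + star β ≠ 0 := by rw [← star_add]; exact star_ne_zero.2 h
  have e1 : zeta c α β * β + zeta c β α * α = α + β := by
    rw [zeta_mul hβ h, zeta_mul hα (by rwa [add_comm]), add_comm β α, add_comm (star β) (star α),
      ← add_div, ← mul_add, add_comm (star β), mul_div_cancel_right₀ _ h']
  have e2 : zeta c α β * β * star (zeta c β α * α) = α * star β := by
    rw [zeta_mul hβ h, zeta_mul hα (by rwa [add_comm])]
    simp only [star_div₀, star_mul, star_add, star_star]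
    rw [add_comm β α, add_comm (star β) (star α)]
    field_simp
  rw [oneAdd_mul_oneAdd, oneAdd_mul_oneAdd, e1, e2]

end Words

/-! ### Reordering words -/

section Reorder

lemma exists_append_of_not_isChain {ι : Type*} {l : List ι} (h : ¬ l.IsChain (· ≠ ·)) :
    ∃ m a m', l = m ++ [a, a] ++ m' := by
  induction l with
  | nil => exact absurd .nil h
  | cons a l ih =>
    cases l with
    | nil => exact absurd (.singleton _) h
    | cons b l =>
      by_cases hab : a = b
      · exact ⟨[], a, l, by simp [hab]⟩
      · obtain ⟨m, x, m', hm⟩ := ih fun h' => h (List.isChain_cons_cons.2 ⟨hab, h'⟩)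
        exact ⟨a :: m, x, m', by rw [hm]; simp⟩

variable {F : Type*} [Field F] {c : F} {S₀ : Finset Fˣ}

/-- The norm of the element `α` of `F[Z]` underlying a letter. -/
def Idx.nm (α : Idx c S₀) : F := QuadraticAlgebra.norm α.1

lemma Idx.exists_nm_eq (α : Idx c S₀) : ∃ τ ∈ S₀, α.nm = (τ : F)⁻¹ := α.2

variable [CharP F 2] [Fact (Irreducible (X ^ 2 + X + C c : F[X]))]

/-- The element of the presented group given by a word. -/
def wordPres (l : List (Idx c S₀)) : PresentedGroup (rels c S₀) :=
  (l.map PresentedGroup.of).prod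

lemma wordPres_append (l l' : List (Idx c S₀)) :
    wordPres (l ++ l') = wordPres l * wordPres l' := by
  simp [wordPres]

lemma wordPres_cons (α : Idx c S₀) (l : List (Idx c S₀)) :
    wordPres (α :: l) = PresentedGroup.of α * wordPres l := by
  simp [wordPres]

lemma of_mul_self (α : Idx c S₀) :
    (PresentedGroup.of α * PresentedGroup.of α : PresentedGroup (rels c S₀)) = 1 := by
  have h : PresentedGroup.mk (rels c S₀) (FreeGroup.of α ^ 2) = 1 :=
    PresentedGroup.one_of_mem (Or.inl ⟨α, rfl⟩)
  rwa [map_pow, pow_two] at h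

/-- Two words have the same letters up to conjugation, and the same products in the presented
group and in the quaternion algebra over `F[t]`. -/
structure SwapEq (l l' : List (Idx c S₀)) : Prop where
  perm : (l.map Idx.nm).Perm (l'.map Idx.nm)
  pres : wordPres l = wordPres l'
  quat : wordQuat l = wordQuat l'

lemma SwapEq.refl (l : List (Idx c S₀)) : SwapEq l l := ⟨.refl _, rfl, rfl⟩

lemma SwapEq.trans {l l' l'' : List (Idx c S₀)} (h : SwapEq l l') (h' : SwapEq l' l'') :
    SwapEq l l'' := ⟨h.perm.trans h'.perm, h.pres.trans h'.pres, h.quat.trans h'.quat⟩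

lemma SwapEq.append {l l' m m' : List (Idx c S₀)} (h : SwapEq l l') (h' : SwapEq m m') :
    SwapEq (l ++ m) (l' ++ m') where
  perm := by simpa using h.perm.append h'.perm
  pres := by rw [wordPres_append, wordPres_append, h.pres, h'.pres]
  quat := by rw [wordQuat_append, wordQuat_append, h.quat, h'.quat]

lemma SwapEq.length_eq {l l' : List (Idx c S₀)} (h : SwapEq l l') : l.length = l'.length := by
  simpa using h.perm.length_eq

lemma SwapEq.unit {l l' : List (Idx c S₀)} (h : SwapEq l l') : wordUnit l = wordUnit l' := by
  apply Units.ext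
  rw [wordUnit_val, wordUnit_val, h.quat]

lemma exists_swapEq_pair {α β : Idx c S₀} (h : α.nm ≠ β.nm) :
    ∃ γ δ : Idx c S₀, γ.nm = β.nm ∧ δ.nm = α.nm ∧ SwapEq [α, β] [γ, δ] := by
  have hs : α.1 + β.1 ≠ 0 := add_ne_zero_of_norm_ne h
  have hs' : β.1 + α.1 ≠ 0 := by rwa [add_comm]
  have hγ := norm_zeta_mul (val_ne_zero β) hs
  have hδ := norm_zeta_mul (val_ne_zero α) hs'
  let γ : Idx c S₀ := ⟨zeta c α.1 β.1 * β.1, by rw [hγ]; exact β.2⟩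
  let δ : Idx c S₀ := ⟨zeta c β.1 α.1 * α.1, by rw [hδ]; exact α.2⟩
  have eγ : γ.nm = β.nm := hγ
  have eδ : δ.nm = α.nm := hδ
  refine ⟨γ, δ, eγ, eδ, ?_, ?_, ?_⟩
  · simpa [eγ, eδ] using List.Perm.swap β.nm α.nm []
  · have h : PresentedGroup.mk (rels c S₀)
        (FreeGroup.of α * FreeGroup.of β * (FreeGroup.of γ * FreeGroup.of δ)⁻¹) = 1 :=
      PresentedGroup.one_of_mem (Or.inr ⟨α, β, γ, δ, h, rfl, rfl, rfl⟩)
    rw [map_mul, map_inv, mul_inv_eq_one, map_mul, map_mul] at h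
    simp only [wordPres, List.map_cons, List.map_nil, List.prod_cons, List.prod_nil, mul_one]
    exact h
  · simpa [wordQuat] using oneAdd_mul_oneAdd_eq F[X] (val_ne_zero α) (val_ne_zero β) hs

/-- The first letter is exchanged with its right neighbours one after another. Both letters change
in each exchange, but their norms do not, so the next exchange is again possible. -/
lemma exists_swapEq_cons (α : Idx c S₀) (l : List (Idx c S₀)) (hl : ∀ β ∈ l, β.nm ≠ α.nm) :
    ∃ (l' : List (Idx c S₀)) (α' : Idx c S₀), α'.nm = α.nm ∧ (∀ β ∈ l', β.nm ≠ α.nm) ∧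
      l'.length = l.length ∧ SwapEq (α :: l) (l' ++ [α']) := by
  induction l generalizing α with
  | nil => exact ⟨[], α, rfl, by simp, rfl, .refl _⟩
  | cons β l ih =>
    obtain ⟨γ, δ, hγ, hδ, h⟩ := exists_swapEq_pair (hl β (by simp)).symm
    obtain ⟨l', α', hα', hl', hlen, h'⟩ := ih δ fun η hη => by
      rw [hδ]; exact hl η (by simp [hη])
    refine ⟨γ :: l', α', hα'.trans hδ, ?_, by simp [hlen],
      (h.append (.refl l)).trans ((SwapEq.refl [γ]).append h')⟩
    intro η hη
    rcases List.mem_cons.1 hη with rfl | hη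
    · rw [hγ]; exact hl β (by simp)
    · rw [← hδ]; exact hl' η hη

/-- The letters of a given norm can be moved to the end. -/
lemma exists_swapEq_append (ν : F) (l : List (Idx c S₀)) :
    ∃ l₁ l₂ : List (Idx c S₀), (∀ α ∈ l₁, α.nm ≠ ν) ∧ (∀ α ∈ l₂, α.nm = ν) ∧
      SwapEq l (l₁ ++ l₂) := by
  induction l with
  | nil => exact ⟨[], [], by simp, by simp, .refl _⟩
  | cons α l ih =>
    obtain ⟨l₁, l₂, h₁, h₂, h⟩ := ih
    have h' := (SwapEq.refl [α]).append h
    by_cases hα : α.nm = ν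
    · subst hα
      obtain ⟨l', α', hα', hl', -, h''⟩ := exists_swapEq_cons α l₁ h₁
      refine ⟨l', α' :: l₂, hl', ?_, h'.trans ?_⟩
      · simpa [hα'] using h₂
      · simpa using h''.append (.refl l₂)
    · exact ⟨α :: l₁, l₂, by simpa [hα] using h₁, h₂, h'⟩

lemma wordPres_cancel (m m' : List (Idx c S₀)) (α : Idx c S₀) :
    wordPres (m ++ [α, α] ++ m') = wordPres (m ++ m') := by
  rw [wordPres_append, wordPres_append, wordPres_append,
    show wordPres [α, α] = 1 by simpa [wordPres] using of_mul_self α, mul_one]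

lemma wordPres_reverse (l : List (Idx c S₀)) : wordPres l.reverse = (wordPres l)⁻¹ := by
  refine eq_inv_of_mul_eq_one_left ?_
  induction l with
  | nil => simp [wordPres]
  | cons α l ih =>
    rw [← wordPres_append, show (α :: l).reverse ++ α :: l = l.reverse ++ [α, α] ++ l by simp,
      wordPres_cancel, wordPres_append, ih]

/-- A nonempty word either can be shortened by cancellation, or can be reordered so that its
letters of some norm form a nonempty reduced word at the end. -/
lemma exists_cancel_or_reduced (l : List (Idx c S₀)) (hl : l ≠ []) :
    (∃ (l' : List (Idx c S₀)) (ν : F), wordPres l = wordPres l' ∧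
      (l.map Idx.nm).Perm ([ν, ν] ++ l'.map Idx.nm)) ∨
    ∃ τ ∈ S₀, ∃ l₁ l₂ : List (Idx c S₀), SwapEq l (l₁ ++ l₂) ∧
      (∀ α ∈ l₁, α.nm ≠ (τ : F)⁻¹) ∧ (∀ α ∈ l₂, α.nm = (τ : F)⁻¹) ∧
      l₂ ≠ [] ∧ l₂.IsChain (· ≠ ·) := by
  obtain ⟨α, l, rfl⟩ := List.exists_cons_of_ne_nil hl
  obtain ⟨τ, hτ, hα⟩ := α.exists_nm_eq
  obtain ⟨l₁, l₂, h₁, h₂, h⟩ := exists_swapEq_append (τ : F)⁻¹ (α :: l)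
  by_cases hr : l₂.IsChain (· ≠ ·)
  · refine Or.inr ⟨τ, hτ, l₁, l₂, h, h₁, h₂, ?_, hr⟩
    -- The norm was taken from the first letter of the word, so the block of that norm cannot be
    -- empty.
    rintro rfl
    have h3 : (τ : F)⁻¹ ∈ (l₁ ++ []).map Idx.nm :=
      h.perm.mem_iff.1 (by rw [← hα]; simp)
    rw [List.append_nil] at h3
    obtain ⟨β, hβ, hβ'⟩ := List.mem_map.1 h3
    exact h₁ β hβ hβ'
  · obtain ⟨m, β, m', rfl⟩ := exists_append_of_not_isChain hr
    refine Or.inl ⟨l₁ ++ m ++ m', β.nm, ?_, h.perm.trans ?_⟩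
    · rw [h.pres, ← List.append_assoc, ← List.append_assoc, wordPres_cancel]
    · have : l₁ ++ (m ++ [β, β] ++ m') = (l₁ ++ m) ++ ([β, β] ++ m') := by simp
      rw [this]
      simp only [List.map_append]
      refine (List.perm_append_comm_assoc _ _ _).trans ?_
      simp

end Reorder

/-! ### The presentation -/

section Presentation

variable {F : Type*} [Field F] (c : F) (S₀ : Finset Fˣ)

lemma gen_mem_PA {α : Idx c S₀} {τ : Fˣ} (h : α.nm = (τ : F)⁻¹) : gen c S₀ α ∈ PA c S₀ τ :=
  ⟨α, h, rfl⟩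

lemma gen_mul_self [CharP F 2] (α : Idx c S₀) : gen c S₀ α * gen c S₀ α = 1 := by
  obtain ⟨τ, hτ, hα⟩ := α.2
  refine (QuotientGroup.eq_one_iff _).2 ⟨(isUnit_one_sub S₀ hτ).unit, Units.ext ?_⟩
  have h := oneAdd_sq (SInt S₀) α.1
  rw [hα] at h
  exact h.symm

variable [CharP F 2] [Fact (Irreducible (X ^ 2 + X + C c : F[X]))]

lemma lift_gen_rels : ∀ r ∈ rels c S₀, FreeGroup.lift (gen c S₀) r = 1 := by
  rintro _ (⟨α, rfl⟩ | ⟨α, β, γ, δ, hne, hγ, hδ, rfl⟩)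
  · rw [map_pow, FreeGroup.lift_apply_of, pow_two, gen_mul_self]
  · rw [map_mul, map_inv, mul_inv_eq_one, map_mul, map_mul]
    simp only [FreeGroup.lift_apply_of]
    refine congrArg QuotientGroup.mk (Units.ext ?_)
    change oneAdd c _ α.1 * oneAdd c _ β.1 = oneAdd c _ γ.1 * oneAdd c _ δ.1
    rw [hγ, hδ]
    exact oneAdd_mul_oneAdd_eq _ (val_ne_zero α) (val_ne_zero β) (add_ne_zero_of_norm_ne hne)

/-- The homomorphism from the presented group to `Λ_S`. -/
def presHom : PresentedGroup (rels c S₀) →* Lam c S₀ :=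
  PresentedGroup.toGroup (lift_gen_rels c S₀)

lemma presHom_of (α : Idx c S₀) : presHom c S₀ (PresentedGroup.of α) = gen c S₀ α :=
  PresentedGroup.toGroup.of _

lemma presHom_wordPres (l : List (Idx c S₀)) :
    presHom c S₀ (wordPres l) = QuotientGroup.mk (wordUnit l) := by
  rw [← prod_gen, wordPres, map_list_prod, List.map_map]
  congr 1
  exact List.map_congr_left fun α _ => presHom_of c S₀ α

lemma exists_wordPres_eq (x : PresentedGroup (rels c S₀)) : ∃ l, wordPres l = x := by
  have hx : x ∈ Subgroup.closure (Set.range (PresentedGroup.of (rels := rels c S₀))) := by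
    rw [PresentedGroup.closure_range_of]; trivial
  induction hx using Subgroup.closure_induction with
  | mem x hx => obtain ⟨α, rfl⟩ := hx; exact ⟨[α], by simp [wordPres]⟩
  | one => exact ⟨[], rfl⟩
  | mul x y _ _ hx hy =>
    obtain ⟨l, rfl⟩ := hx
    obtain ⟨l', rfl⟩ := hy
    exact ⟨l ++ l', wordPres_append l l'⟩
  | inv x _ hx =>
    obtain ⟨l, rfl⟩ := hx
    exact ⟨l.reverse, wordPres_reverse l⟩

/-- Induction on the length: a cancellation shortens the word, and a reduced block at some place
contradicts scalarity. -/
lemma wordPres_eq_one_of_wordUnit_mem (l : List (Idx c S₀)) (h : wordUnit l ∈ scalars c S₀) :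
    wordPres l = 1 := by
  induction hn : l.length using Nat.strong_induction_on generalizing l with
  | _ n ih =>
    rcases eq_or_ne l [] with rfl | hl
    · rfl
    rcases exists_cancel_or_reduced l hl with
      ⟨l', ν, hw, hp⟩ | ⟨τ, hτ, l₁, l₂, hs, h₁, h₂, hne, hr⟩
    · rw [hw]
      refine ih l'.length ?_ l' ?_ rfl
      · have := hp.length_eq
        simp at this
        omega
      · rw [← QuotientGroup.eq_one_iff] at h ⊢
        rwa [← presHom_wordPres, ← hw, presHom_wordPres]
    · rw [hs.unit] at h
      exact absurd h (wordUnit_append_notMem_scalars τ.ne_zero h₁ h₂ hne hr)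

lemma presHom_injective : Function.Injective (presHom c S₀) := by
  rw [injective_iff_map_eq_one]
  intro x hx
  obtain ⟨l, rfl⟩ := exists_wordPres_eq c S₀ x
  rw [presHom_wordPres, QuotientGroup.eq_one_iff] at hx
  exact wordPres_eq_one_of_wordUnit_mem c S₀ l hx

lemma presHom_range : (presHom c S₀).range = Gam c S₀ := by
  rw [MonoidHom.range_eq_map, ← PresentedGroup.closure_range_of, MonoidHom.map_closure, Gam]
  congr 1
  ext x
  simp only [Set.mem_image, Set.mem_range, exists_exists_eq_and, Set.mem_iUnion]
  constructor
  · rintro ⟨α, rfl⟩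
    obtain ⟨τ, hτ, h⟩ := α.exists_nm_eq
    exact ⟨τ, hτ, by rw [presHom_of]; exact gen_mem_PA c S₀ h⟩
  · rintro ⟨τ, -, α, -, rfl⟩
    exact ⟨α, presHom_of c S₀ α⟩

/-- The presentation of `Γ_S`. -/
def presEquiv : PresentedGroup (rels c S₀) ≃* Gam c S₀ :=
  (MonoidHom.ofInjective (presHom_injective c S₀)).trans
    (MulEquiv.subgroupCongr (presHom_range c S₀))

lemma presEquiv_apply (x : PresentedGroup (rels c S₀)) :
    (presEquiv c S₀ x : Lam c S₀) = presHom c S₀ x := rfl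

end Presentation

/-! ### Matrices stabilizing a lattice -/

section Stabilizer

variable {E : Type*} [Field E] {O : ValuationSubring E}

/-- A finitely generated torsion-free module over a valuation ring is free. An `O`-basis of `L` is
an `E`-basis of `E²`, and in it the endomorphism has entries in `O`. -/
lemma trace_mem_and_det_mem (L : Lat O) (N : Matrix (Fin 2) (Fin 2) E)
    (h : ∀ x ∈ L.1, N.mulVec x ∈ L.1) : N.trace ∈ O ∧ N.det ∈ O := by
  obtain ⟨L, hL⟩ := L
  have := hL
  have : Module.IsTorsionFree O (Fin 2 → E) := Module.IsTorsionFree.trans_faithfulSMul O E _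
  have : Module.Flat O L := by
    rw [Module.Flat.flat_iff_torsion_eq_bot_of_isBezout,
      ← Submodule.isTorsionFree_iff_torsion_eq_bot]
    infer_instance
  have : Module.Free O L := Module.free_of_flat_of_isLocalRing
  let b := Module.Free.chooseBasis O L
  let B := b.extendOfIsLattice E
  let f : L →ₗ[O] L := ((Matrix.toLin' N).restrictScalars O).restrict h
  have hf : LinearMap.toMatrix B B (Matrix.toLin' N) =
      (LinearMap.toMatrix b b f).map (algebraMap O E) := by
    ext i j
    rw [LinearMap.toMatrix_apply, Matrix.map_apply, LinearMap.toMatrix_apply]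
    have h1 : Matrix.toLin' N (B j) = ∑ k, (algebraMap O E (b.repr (f (b j)) k)) • B k := by
      have h2 : Matrix.toLin' N (B j) = (f (b j) : Fin 2 → E) := by
        rw [Module.Basis.extendOfIsLattice_apply]; rfl
      rw [h2]
      conv_lhs => rw [← b.sum_repr (f (b j))]
      rw [Submodule.coe_sum]
      refine Finset.sum_congr rfl fun k _ => ?_
      rw [Module.Basis.extendOfIsLattice_apply, algebraMap_smul]
      rfl
    rw [h1, map_sum, Finset.sum_apply']
    simp [Finsupp.single_apply]
  constructor
  · have h3 : N.trace = LinearMap.trace E _ (Matrix.toLin' N) := (Matrix.trace_toLin'_eq N).symm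
    rw [h3, LinearMap.trace_eq_matrix_trace E B, hf, ← AddMonoidHom.map_trace]
    exact Subtype.property _
  · have h3 : N.det = LinearMap.det (Matrix.toLin' N) := (LinearMap.det_toLin' N).symm
    rw [h3, ← LinearMap.det_toMatrix B, hf, ← RingHom.mapMatrix_apply, ← RingHom.map_det]
    exact Subtype.property _

/-- The quotient is unchanged when `g` is rescaled, so `g` may be assumed to preserve a lattice and
not only its class. Then its trace and the determinant of its inverse lie in `O`. -/
lemma trace_sq_div_det_mem (g : GL (Fin 2) E) (P : Vertex O) (h : g • P = P) :
    g.1.trace ^ 2 / g.1.det ∈ O := by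
  induction P using Quotient.inductionOn with
  | h L =>
    obtain ⟨a, ha⟩ : ∃ a : Eˣ, L = Lat.map O (scalarGL a) (Lat.map O g L) := Quotient.exact h
    rw [← Lat.map_mul] at ha
    set N := scalarGL a * g with hN
    have ha' : L = Lat.map O N⁻¹ L := by
      conv_rhs => rw [ha, ← Lat.map_mul, inv_mul_cancel, Lat.map_one]
    have key : ∀ M : GL (Fin 2) E, L = Lat.map O M L → ∀ x ∈ L.1, M.1.mulVec x ∈ L.1 := by
      intro M hM x hx
      have h1 : M.1.mulVec x ∈ (Lat.map O M L).1 := ⟨x, hx, rfl⟩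
      rwa [← hM] at h1
    have h1 := (trace_mem_and_det_mem L N.1 (key N ha)).1
    have h2 := (trace_mem_and_det_mem L N⁻¹.1 (key N⁻¹ ha')).2
    have h3 : N.1 = (a : E) • g.1 := by
      rw [hN, Algebra.smul_def]; rfl
    have hdet : g.1.det ≠ 0 := (Matrix.isUnits_det_units g).ne_zero
    have h4 : N⁻¹.1.det * ((a : E) ^ 2 * g.1.det) = 1 := by
      have : (N⁻¹).1 * N.1 = 1 := N.inv_mul
      rw [← Matrix.det_one (n := Fin 2) (R := E), ← this, Matrix.det_mul, h3, Matrix.det_smul]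
      simp
    have h5 : g.1.trace ^ 2 / g.1.det = N.1.trace ^ 2 * N⁻¹.1.det := by
      rw [h3, Matrix.trace_smul, smul_eq_mul, div_eq_iff hdet]
      linear_combination -g.1.trace ^ 2 * h4
    rw [h5]
    exact O.mul_mem _ _ (pow_mem h1 2) h2

end Stabilizer

/-! ### Reduced trace and norm under a splitting -/

/-- Both pairs are coefficients of a monic quadratic equation for `φ y`. These agree unless `φ y` is
scalar, and scalars have reduced trace `2r = 0`. -/
lemma trace_det_of_algEquiv {K : Type*} [Field K] [CharP K 2] {a b : K}
    (φ : ℍ[K,a,1,b] ≃ₐ[K] Matrix (Fin 2) (Fin 2) K) {y : ℍ[K,a,1,b]} (hy : trd y ≠ 0) :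
    (φ y).trace = trd y ∧ (φ y).det = nrd y := by
  have h1 : φ y * φ y = trd y • φ y - nrd y • 1 := by
    rw [← map_mul, sq_eq_trd_sub_nrd, map_sub, map_mul, AlgEquiv.commutes, AlgEquiv.commutes,
      Algebra.smul_def, Algebra.smul_def, mul_one]
  have h2 : φ y * φ y = (φ y).trace • φ y - (φ y).det • 1 := by
    ext i j
    fin_cases i <;> fin_cases j <;>
      simp [Matrix.mul_apply, Fin.sum_univ_two, Matrix.trace, Matrix.det_fin_two] <;> ring
  have h3 : (trd y - (φ y).trace) • φ y = (nrd y - (φ y).det) • 1 := by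
    rw [sub_smul, sub_smul, sub_eq_sub_iff_sub_eq_sub]
    exact h1.symm.trans h2
  have h4 : trd y - (φ y).trace = 0 := by
    by_contra hne
    apply hy
    have h5 : φ y = algebraMap K _ ((trd y - (φ y).trace)⁻¹ * (nrd y - (φ y).det)) := by
      rw [Algebra.algebraMap_eq_smul_one, mul_smul, ← h3, inv_smul_smul₀ hne]
    rw [← AlgEquiv.commutes φ] at h5
    rw [φ.injective h5, trd_algebraMap, CharTwo.two_eq_zero, zero_mul]
  refine ⟨(sub_eq_zero.1 h4).symm, ?_⟩
  rw [h4, zero_smul] at h3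
  have h6 := congrFun (congrFun h3 0) 0
  simp at h6
  exact (sub_eq_zero.1 h6.symm).symm

/-! ### Hyperbolic elements -/

section Hyperbolic

/-- The valuation of the reduced trace of a power of a hyperbolic element. -/
lemma valuation_trd_pow {K Γ₀ : Type*} [Field K] [CharP K 2] [LinearOrderedCommGroupWithZero Γ₀]
    (v : Valuation K Γ₀) {a b : K} {x : ℍ[K,a,1,b]} (hx : v (nrd x) < v (trd x) ^ 2) (n : ℕ) :
    v (trd (x ^ (n + 1))) = v (trd x) ^ (n + 1) ∧ v (trd (x ^ n)) ≤ v (trd x) ^ n := by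
  have hpos : 0 < v (trd x) := by
    rw [zero_lt_iff]
    rintro h
    simp [h] at hx
  induction n with
  | zero =>
    have : trd (1 : ℍ[K,a,1,b]) = 0 := by
      rw [← map_one (algebraMap K ℍ[K,a,1,b]), trd_algebraMap, CharTwo.two_eq_zero, zero_mul]
    simp [this]
  | succ n ih =>
    refine ⟨?_, ih.1.le⟩
    -- In the recursion the term with `nrd x` is strictly smaller. For the lower index only an
    -- inequality is available, because `x ^ 0` has trace `2 = 0`.
    rw [trd_pow_add_two, Valuation.map_sub_eq_of_lt_left, map_mul, ih.1, ← pow_succ']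
    rw [map_mul, map_mul, ih.1, ← pow_succ']
    calc v (nrd x) * v (trd (x ^ n)) ≤ v (nrd x) * v (trd x) ^ n := by gcongr; exact ih.2
      _ < v (trd x) ^ 2 * v (trd x) ^ n :=
        mul_lt_mul_of_pos_right hx (zero_lt_iff.2 (pow_ne_zero _ hpos.ne'))
      _ = v (trd x) ^ (n + 1 + 1) := by rw [← pow_add]; congr 1; omega

variable {F : Type*} [Field F] {c : F} (S₀ : Finset Fˣ)

/-- The image of an element of `𝒜(𝔬_{K,S})ˣ` in the quaternion algebra over `K_τ`. -/
def localize (τ : Fˣ) : GLA c S₀ →* Quat c (Kv τ) :=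
  (Quat.map c (toKv S₀ τ) : Quat c (SInt S₀) →* Quat c (Kv τ)).comp (Units.coeHom _)

/-- An element of `𝒜(𝔬_{K,S})ˣ` is hyperbolic at `τ` if the square of its reduced trace is of
larger absolute value than its reduced norm. -/
def IsHyp (τ : Fˣ) (u : GLA c S₀) : Prop :=
  Valued.v (nrd (localize S₀ τ u)) < Valued.v (trd (localize S₀ τ u)) ^ 2

lemma IsHyp.conj {τ : Fˣ} {u : GLA c S₀} (h : IsHyp S₀ τ u) (w : GLA c S₀) :
    IsHyp S₀ τ (w * u * w⁻¹) := by
  have h1 : localize S₀ τ w⁻¹ * localize S₀ τ w = 1 := by rw [← map_mul]; simp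
  have h2 : nrd (localize S₀ τ w) * nrd (localize S₀ τ w⁻¹) = 1 := by
    rw [mul_comm, ← nrd_mul, h1, nrd_one]
  rw [IsHyp] at h ⊢
  rwa [map_mul, map_mul, trd_mul_comm, ← mul_assoc, h1, one_mul, nrd_mul, nrd_mul,
    mul_right_comm, h2, one_mul]

variable [CharP F 2]

instance (τ : Fˣ) : CharP (Kv τ) 2 :=
  charP_of_injective_algebraMap (algebraMap F (Kv τ)).injective 2

lemma IsHyp.pow {τ : Fˣ} {u : GLA c S₀} (h : IsHyp S₀ τ u) {n : ℕ} (hn : n ≠ 0) :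
    IsHyp S₀ τ (u ^ n) := by
  obtain ⟨n, rfl⟩ := Nat.exists_eq_succ_of_ne_zero hn
  rw [IsHyp, map_pow, (valuation_trd_pow _ h n).1, nrd_pow, map_pow, ← pow_mul, mul_comm,
    pow_mul]
  exact pow_lt_pow_left₀ h zero_le (by omega)

lemma IsHyp.notMem_scalars {τ : Fˣ} {u : GLA c S₀} (h : IsHyp S₀ τ u) : u ∉ scalars c S₀ := by
  rintro ⟨s, rfl⟩
  have : localize S₀ τ (Units.map (algebraMap (SInt S₀) (Quat c (SInt S₀)) :
      SInt S₀ →* Quat c (SInt S₀)) s) = algebraMap _ _ (toKv S₀ τ s) :=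
    map_algebraMap c (toKv S₀ τ) s
  rw [IsHyp, this, trd_algebraMap, CharTwo.two_eq_zero, zero_mul, map_zero] at h
  simp at h

lemma IsHyp.smul_ne {τ : Fˣ} {u : GLA c S₀} (h : IsHyp S₀ τ u) (φ : Splitting c τ)
    (P : Vertex (Ov τ)) : toGL S₀ φ u • P ≠ P := by
  intro hP
  have h1 := trace_sq_div_det_mem _ _ hP
  have hdet : (toGL S₀ φ u).1.det ≠ 0 := (Matrix.isUnits_det_units _).ne_zero
  have e : (toGL S₀ φ u).1 = φ (localize S₀ τ u) := rfl
  have htr : trd (localize S₀ τ u) ≠ 0 := by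
    intro h0
    simp [IsHyp, h0] at h
  rw [e] at h1 hdet
  obtain ⟨e1, e2⟩ := trace_det_of_algEquiv φ htr
  rw [e2] at hdet
  rw [e1, e2, HeightOneSpectrum.mem_adicCompletionIntegers, map_div₀, map_pow,
    div_le_one₀ ((Valuation.pos_iff _).2 hdet)] at h1
  exact absurd h (not_lt.2 h1)

/-- An edge mapped to itself without a fixed vertex is inverted; then the square, again hyperbolic,
would fix its ends. -/
lemma IsHyp.image_ne {τ : Fˣ} {u : GLA c S₀} (h : IsHyp S₀ τ u) (φ : Splitting c τ)
    {D : Set (Vertex (Ov τ))} (hD : IsTreeCell (Ov τ) D) :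
    ∃ P ∈ D, toGL S₀ φ u • P ∉ D := by
  by_contra! hm
  have hu := h.smul_ne S₀ φ
  rcases hD with ⟨P, rfl⟩ | ⟨P, Q, -, rfl⟩
  · exact hu P (by simpa using hm P)
  · have hP := hm P (by simp)
    have hQ := hm Q (by simp)
    simp only [Set.mem_insert_iff, Set.mem_singleton_iff, hu, false_or, or_false] at hP hQ
    have h2 := (h.pow S₀ two_ne_zero).smul_ne S₀ φ P
    rw [map_pow, pow_two, mul_smul, hP, hQ] at h2
    exact h2 rfl

lemma IsHyp.act_image_ne {τ : S₀} {u : GLA c S₀} (h : IsHyp S₀ τ u)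
    (φ : ∀ τ : S₀, Splitting c (τ : Fˣ)) {D : Set (PT S₀)} (hD : IsCell S₀ D) :
    act S₀ φ (QuotientGroup.mk u) '' D ≠ D := by
  intro hfix
  obtain ⟨C, hC, rfl⟩ := hD
  obtain ⟨P, hP, hP'⟩ := h.image_ne S₀ (φ τ) (hC τ)
  have hne : ∀ σ : S₀, (C σ).Nonempty := fun σ => by
    rcases hC σ with ⟨Q, hQ⟩ | ⟨Q, Q', -, hQ⟩ <;> rw [hQ] <;> simp
  classical
  choose p hp using hne
  -- A vertex of the product cell whose coordinate at `τ` leaves `C τ`; the other coordinates are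
  -- arbitrary.
  have hmem : Function.update p τ P ∈ Set.univ.pi C := by
    intro σ _
    by_cases hσ : σ = τ
    · subst hσ; simpa using hP
    · simpa [hσ] using hp σ
  have h1 : act S₀ φ (QuotientGroup.mk u) (Function.update p τ P) ∈ Set.univ.pi C := by
    rw [← hfix]
    exact Set.mem_image_of_mem _ hmem
  have h2 : toGL S₀ (φ τ) u • (Function.update p τ P) τ ∈ C τ := h1 τ trivial
  rw [Function.update_self] at h2
  exact hP' h2

end Hyperbolic

/-! ### Splitting of the quaternion algebra -/

section Split

/-- The hypothesis says that `b` is the norm of `u + vZ`. The algebra acts on `K[Z]`, with basis `1,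
Z`: `Z` by multiplication and `F` by `x ↦ (u + vZ)x̄`. The action is faithful, and dimensions agree.
-/
lemma nonempty_algEquiv_of_norm {K : Type*} [Field K] [CharP K 2] {a b u v : K} (hb : b ≠ 0)
    (h : u ^ 2 + u * v - a * v ^ 2 = b) :
    Nonempty (ℍ[K,a,1,b] ≃ₐ[K] Matrix (Fin 2) (Fin 2) K) := by
  have h2 : (2 : K) = 0 := CharTwo.two_eq_zero
  let B : QuaternionAlgebra.Basis (Matrix (Fin 2) (Fin 2) K) a 1 b :=
    { i := !![0, a; 1, 1]
      j := !![u, u - a * v; v, -u]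
      k := !![a * v, -(a * u); u + v, -(a * v)]
      i_mul_i := by
        ext i j; fin_cases i <;> fin_cases j <;> simp
      j_mul_j := by
        rw [← h]
        ext i j; fin_cases i <;> fin_cases j <;> simp <;> ring
      i_mul_j := by
        ext i j; fin_cases i <;> fin_cases j <;> simp
        ring
      j_mul_i := by
        ext i j; fin_cases i <;> fin_cases j <;> simp <;> ring }
  have hinj : Function.Injective B.liftHom := by
    rw [injective_iff_map_eq_zero]
    rintro ⟨p, q, r, s⟩ hx
    have e : ∀ i j, (B.liftHom ⟨p, q, r, s⟩) i j = 0 := fun i j => by rw [hx]; rfl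
    have e00 := e 0 0
    have e01 := e 0 1
    have e10 := e 1 0
    have e11 := e 1 1
    simp [QuaternionAlgebra.Basis.liftHom, QuaternionAlgebra.Basis.lift, B,
      Algebra.algebraMap_eq_smul_one] at e00 e01 e10 e11
    have hq : q = 0 := by linear_combination e00 + e11 - p * h2
    have hp : p = 0 := by linear_combination e00 - a * e10 - e01 + a * q * h2
    subst hp hq
    have hr : r * b = 0 := by rw [← h]; linear_combination (u + v) * e00 - a * v * e10
    have hs : s * b = 0 := by rw [← h]; linear_combination u * e10 - v * e00
    rw [(mul_eq_zero.1 hr).resolve_right hb, (mul_eq_zero.1 hs).resolve_right hb]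
    rfl
  refine ⟨AlgEquiv.ofBijective B.liftHom ⟨hinj, ?_⟩⟩
  refine (LinearMap.injective_iff_surjective_of_finrank_eq_finrank
    (f := B.liftHom.toLinearMap) ?_).1 hinj
  rw [QuaternionAlgebra.finrank_eq_four, Module.finrank_matrix]
  simp

lemma nonarchimedeanAddGroup (K : Type*) {Γ₀ : Type*} [Field K]
    [LinearOrderedCommGroupWithZero Γ₀] [Valued K Γ₀] : NonarchimedeanAddGroup K where
  is_nonarchimedean U hU := by
    obtain ⟨γ, hγ⟩ := Valued.mem_nhds_zero.1 hU
    exact ⟨⟨(Valued.v.restrict : Valuation K _).ltAddSubgroup γ, Valued.isOpen_ball K γ.1⟩, hγ⟩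

/-- The equation `y² + y = a` is solvable in a complete field of characteristic two if `|a| < 1`. -/
lemma exists_sq_add_eq {K : Type*} [Field K] [Valued K (WithZero (Multiplicative ℤ))]
    [CompleteSpace K] [CharP K 2] {a : K} (ha : Valued.v a < 1) : ∃ y : K, y ^ 2 + y = a := by
  -- The solution is the Artin–Schreier series `y = ∑ a ^ 2 ^ k`: squaring shifts it by one term, so
  -- `y² + y` leaves only `a`.
  have ht : Filter.Tendsto (fun k : ℕ => a ^ 2 ^ k) Filter.atTop (nhds 0) := by
    have h1 : Filter.Tendsto (fun n : ℕ => a ^ n) Filter.atTop (nhds 0) := by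
      exact Valued.tendsto_zero_pow_of_v_lt_one ha
    exact h1.comp (tendsto_pow_atTop_atTop_of_one_lt one_lt_two)
  have hs : Summable fun k : ℕ => a ^ 2 ^ k :=
    have := nonarchimedeanAddGroup K
    NonarchimedeanAddGroup.summable_of_tendsto_cofinite_zero (by rwa [Nat.cofinite_eq_atTop])
  refine ⟨∑' k, a ^ 2 ^ k, ?_⟩
  have h1 : (∑' k : ℕ, a ^ 2 ^ k) ^ 2 = ∑' k : ℕ, a ^ 2 ^ (k + 1) := by
    have := hs.map_tsum (frobenius K 2) (by
      exact continuous_pow 2)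
    rw [frobenius_def] at this
    rw [this]
    refine tsum_congr fun k => ?_
    rw [frobenius_def, ← pow_mul, pow_succ]
  rw [h1, hs.tsum_eq_zero_add, pow_zero, pow_one, add_left_comm, CharTwo.add_self_eq_zero, add_zero]

variable {F : Type*} [Field F]

lemma valued_algebraMap_lt_one_iff (τ : Fˣ) (p : F[X]) :
    Valued.v (algebraMap F[X] (Kv τ) p) < 1 ↔ p.eval (τ : F) = 0 := by
  rw [IsScalarTower.algebraMap_apply F[X] (RatFunc F) (Kv τ)]
  have := HeightOneSpectrum.valuedAdicCompletion_eq_valuation' (v := place (τ : F)) (algebraMap F[X] (RatFunc F) p)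
  erw [this]
  rw [HeightOneSpectrum.valuation_lt_one_iff_mem, place, Ideal.mem_span_singleton,
    dvd_iff_isRoot, IsRoot.def]

lemma valued_algebraMap_le_one (τ : Fˣ) (p : F[X]) :
    Valued.v (algebraMap F[X] (Kv τ) p) ≤ 1 := by
  rw [IsScalarTower.algebraMap_apply F[X] (RatFunc F) (Kv τ)]
  have := HeightOneSpectrum.valuedAdicCompletion_eq_valuation' (v := place (τ : F)) (algebraMap F[X] (RatFunc F) p)
  erw [this]
  exact HeightOneSpectrum.valuation_le_one _ _

variable [Finite F] [CharP F 2] (c : F)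

lemma nonempty_splitting (hc : c ≠ 0) (τ : Fˣ) : Nonempty (Splitting c τ) := by
  obtain ⟨s, hs⟩ : ∃ s : F, (τ : F) = s * s := FiniteField.isSquare_of_char_two (ringChar.eq F 2) _
  have hs0 : s ≠ 0 := by
    rintro rfl
    exact τ.ne_zero (by rw [hs, zero_mul])
  let f : F →+* Kv τ := (algebraMap F[X] (Kv τ)).comp C
  let t : Kv τ := algebraMap F[X] (Kv τ) X
  have hft : t - f τ = algebraMap F[X] (Kv τ) (X - C (τ : F)) := by simp [t, f]
  -- It remains to write `t` as a norm. With `v = s/c` and `u = s + vy`, the terms `sv` and `cv²`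
  -- cancel, and the norm is `s² + v²(y² + y)`. As `s² = τ`, this equals `t` exactly for the `y`
  -- below, and the right-hand side is small because of the factor `t - τ`.
  obtain ⟨y, hy⟩ : ∃ y : Kv τ, y ^ 2 + y = (t - f τ) * f (c / s) ^ 2 := by
    refine exists_sq_add_eq ?_
    rw [hft, ← map_pow, show f ((c / s) ^ 2) = algebraMap F[X] (Kv τ) (C ((c / s) ^ 2)) from rfl,
      ← map_mul, valued_algebraMap_lt_one_iff]
    simp
  have h2 : (2 : Kv τ) = 0 := CharTwo.two_eq_zero
  have hv : f (c / s) * f (s / c) = 1 := by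
    rw [← map_mul, div_mul_div_comm, mul_comm, div_self (mul_ne_zero hs0 hc), map_one]
  have hcv : f c * f (s / c) = f s := by rw [← map_mul, mul_div_cancel₀ _ hc]
  have hτ : f τ = f s ^ 2 := by rw [pow_two, ← map_mul]; exact congrArg f hs
  refine nonempty_algEquiv_of_norm (u := f s + f (s / c) * y) (v := f (s / c)) ?_ ?_
  · intro h
    have := (valued_algebraMap_lt_one_iff τ X).1 (by rw [h]; simp)
    simp at this
  · change _ - f c * _ = t
    have e1 : f (s / c) ^ 2 * (y ^ 2 + y) = t - f s ^ 2 := by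
      rw [hy, hτ]
      linear_combination (t - f s ^ 2) * (f (c / s) * f (s / c) + 1) * hv
    linear_combination e1 - f (s / c) * hcv + (f s * f (s / c) * y) * h2

end Split

/-! ### Even words -/

section Even

variable {F : Type*} [Field F] {c : F} {S₀ : Finset Fˣ}

open Classical in
/-- Every norm occurs an even number of times in the word. -/
def EvenWord (l : List (Idx c S₀)) : Prop := ∀ ν : F, Even ((l.map Idx.nm).count ν)

lemma localize_wordUnit (τ : Fˣ) (l : List (Idx c S₀)) :
    localize S₀ τ (wordUnit l) = Quat.map c (Algebra.ofId F[X] (Kv τ)) (wordQuat l) := by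
  change Quat.map c (toKv S₀ τ) (wordUnit l : Quat c (SInt S₀)) = _
  rw [wordUnit_val]
  apply QuaternionAlgebra.ext <;> exact (toKv S₀ τ).commutes _

/-- Words have polynomial coordinates, so the trace has absolute value one as soon as it is nonzero
at `τ`, while the norm has absolute value less than one. -/
lemma isHyp_wordUnit {τ : Fˣ} {l : List (Idx c S₀)}
    (hn : nrd (evalQuat c (τ : F) (wordQuat l)) = 0)
    (ht : trd (evalQuat c (τ : F) (wordQuat l)) ≠ 0) : IsHyp S₀ τ (wordUnit l) := by
  rw [nrd_evalQuat] at hn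
  rw [trd_evalQuat] at ht
  have h1 : Valued.v (algebraMap F[X] (Kv τ) (nrd (wordQuat l))) < 1 :=
    (valued_algebraMap_lt_one_iff τ _).2 hn
  have h2 : Valued.v (algebraMap F[X] (Kv τ) (trd (wordQuat l))) = 1 :=
    le_antisymm (valued_algebraMap_le_one τ _)
      (not_lt.1 (mt (valued_algebraMap_lt_one_iff τ _).1 ht))
  rw [IsHyp, localize_wordUnit, nrd_map, trd_map]
  change Valued.v (algebraMap F[X] (Kv τ) _) < Valued.v (algebraMap F[X] (Kv τ) _) ^ 2
  rwa [h2, one_pow]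

variable [CharP F 2] [Fact (Irreducible (X ^ 2 + X + C c : F[X]))]

/-- If a word is reduced at `τ` and its trace vanishes modulo `t - τ`, then moving its last letter
to the front makes it cancel. -/
lemma exists_cyclic_cancel {b : F} (hb : b ≠ 0) {l₁ m : List (Idx c S₀)} {α : Idx c S₀}
    (h₁ : ∀ β ∈ l₁, β.nm ≠ b⁻¹) (h₂ : ∀ β ∈ m ++ [α], β.nm = b⁻¹)
    (hr : (m ++ [α]).IsChain (· ≠ ·))
    (ht : trd (evalQuat c b (wordQuat (l₁ ++ (m ++ [α])))) = 0) :
    ∃ (l' : List (Idx c S₀)) (α' : Idx c S₀), α'.nm = α.nm ∧ SwapEq (α :: l₁) (l' ++ [α']) ∧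
      (m ++ [α]).head? = some α' := by
  have hα : α.nm = b⁻¹ := h₂ α (by simp)
  have hbα : b * QuadraticAlgebra.norm α.1 = 1 := by
    rw [show QuadraticAlgebra.norm α.1 = b⁻¹ from hα, mul_inv_cancel₀ hb]
  obtain ⟨l', α', hα', hl', -, hs⟩ := exists_swapEq_cons α l₁ (by rwa [hα])
  refine ⟨l', α', hα', hs, ?_⟩
  have hw : ∀ β : Idx c S₀, evalQuat c b (wordQuat [β]) = oneAddAt b β.1 := fun β => by
    rw [show wordQuat [β] = oneAdd c F[X] β.1 by simp [wordQuat], evalQuat_oneAdd]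
  -- At `b` the word is `ν(1 + αF)` with trace zero, hence is annihilated by `1 + αF` from the left.
  have h0 : evalQuat c b (wordQuat (α :: l₁ ++ (m ++ [α]))) = 0 := by
    have e1 : wordQuat (α :: l₁ ++ (m ++ [α])) =
        wordQuat [α] * (wordQuat (l₁ ++ m) * wordQuat [α]) := by
      rw [← wordQuat_append, ← wordQuat_append]; simp
    have e2 : wordQuat (l₁ ++ (m ++ [α])) = wordQuat (l₁ ++ m) * wordQuat [α] := by
      rw [← wordQuat_append]; simp
    rw [e2, map_mul, hw, mul_oneAddAt hbα] at ht
    rw [e1, map_mul, map_mul, hw, mul_oneAddAt hbα (evalQuat c b (wordQuat (l₁ ++ m)))]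
    exact oneAddAt_mul_of_trd hbα _ ht
  -- After `α` is moved across `l₁`, the letters of `l'` are invertible at `b` and can be dropped.
  -- The remaining word consists of letters at `b` and vanishes, so it is not reduced; this can only
  -- happen at its first two letters.
  have h3 : evalQuat c b (wordQuat (α' :: (m ++ [α]))) = 0 := by
    refine eq_zero_of_mul_eq_zero_of_nrd_ne_zero
      (nrd_evalQuat_wordQuat_ne_zero (b := b) (l := l') ?_) ?_
    · intro β hβ h
      exact hl' β hβ (h.trans hα.symm)
    · rw [← map_mul, ← wordQuat_append, show l' ++ α' :: (m ++ [α]) = (l' ++ [α']) ++ (m ++ [α])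
        by simp, wordQuat_append, ← hs.quat, ← wordQuat_append]
      exact h0
  by_contra hne
  refine evalQuat_wordQuat_ne_zero (b := b) ?_ hb ?_ h3
  · intro β hβ
    rcases List.mem_cons.1 hβ with rfl | hβ
    · exact hα'.trans hα
    · exact h₂ β hβ
  · rw [List.isChain_cons]
    refine ⟨?_, hr⟩
    rintro β hβ rfl
    exact hne hβ

variable (c S₀) in
/-- An element of `Λ_S` is hyperbolic at `τ` if it has a hyperbolic representative. -/
def IsHypClass (τ : Fˣ) (g : Lam c S₀) : Prop :=
  ∃ u : GLA c S₀, QuotientGroup.mk u = g ∧ IsHyp S₀ τ u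

/-- A word in which each norm occurs an even number of times is trivial or hyperbolic somewhere. -/
lemma EvenWord.eq_one_or_isHypClass {l : List (Idx c S₀)} (hl : EvenWord l) :
    wordPres l = 1 ∨ ∃ τ ∈ S₀, IsHypClass c S₀ τ (presHom c S₀ (wordPres l)) := by
  classical
  induction hn : l.length using Nat.strong_induction_on generalizing l with
  | _ n ih =>
    rcases eq_or_ne l [] with rfl | hne
    · exact Or.inl rfl
    rcases exists_cancel_or_reduced l hne with
      ⟨l', ν, hw, hp⟩ | ⟨τ, hτ, l₁, l₂, hs, h₁, h₂, hne', hr⟩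
    · rw [hw]
      refine ih l'.length ?_ (fun μ => ?_) rfl
      · have := hp.length_eq
        simp at this
        omega
      · have h := hl μ
        rw [hp.count_eq, List.count_append] at h
        by_cases hμ : ν = μ <;> simp [hμ, parity_simps] at h ⊢ <;> exact h
    · by_cases ht : trd (evalQuat c (τ : F) (wordQuat (l₁ ++ l₂))) = 0
      swap
      · refine Or.inr ⟨τ, hτ, wordUnit (l₁ ++ l₂), ?_, isHyp_wordUnit ?_ ht⟩
        · rw [hs.pres, presHom_wordPres]
        · rw [wordQuat_append, map_mul, nrd_mul,
            nrd_evalQuat_wordQuat_eq_zero h₂ τ.ne_zero hne', mul_zero]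
      obtain ⟨m, α, rfl⟩ := (List.eq_nil_or_concat l₂).resolve_left hne'
      rw [List.concat_eq_append] at *
      obtain ⟨l', α', hα', hs', hhead⟩ := exists_cyclic_cancel τ.ne_zero h₁ h₂ hr ht
      have hα : α.nm = (τ : F)⁻¹ := h₂ α (by simp)
      have hcount : ∀ ν, ((α :: l₁).map Idx.nm).count ν = ((l' ++ [α']).map Idx.nm).count ν :=
        fun ν => hs'.perm.count_eq ν
      cases m with
      -- A block of one letter would make the number of letters of norm `τ⁻¹` odd.
      | nil =>
        exfalso
        have h := hl (τ : F)⁻¹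
        have h0 : (l₁.map Idx.nm).count (τ : F)⁻¹ = 0 :=
          List.count_eq_zero.2 fun hm => by
            obtain ⟨β, hβ, hβ'⟩ := List.mem_map.1 hm
            exact h₁ β hβ hβ'
        rw [hs.perm.count_eq, List.map_append, List.count_append, h0] at h
        simp [hα] at h
      | cons a m =>
        obtain rfl : a = α' := by simpa using hhead
        -- Conjugation by the last letter cancels `α` at the end and, after the move across `l₁`,
        -- cancels `a` at the start of the block.
        have hconj : PresentedGroup.of α * wordPres l * (PresentedGroup.of α)⁻¹ =
            wordPres (l' ++ m) := by
          rw [inv_eq_of_mul_eq_one_left (of_mul_self α), hs.pres]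
          have e1 : (PresentedGroup.of α : PresentedGroup (rels c S₀)) = wordPres [α] := by
            simp [wordPres]
          rw [e1, ← wordPres_append, ← wordPres_append,
            show [α] ++ (l₁ ++ (a :: m ++ [α])) ++ [α] = (α :: l₁) ++ (a :: m ++ [α, α] ++ []) by
              simp, wordPres_append, hs'.pres, wordPres_cancel, ← wordPres_append,
            show l' ++ [a] ++ (a :: m ++ []) = l' ++ [a, a] ++ m by simp, wordPres_cancel]
        have hev : EvenWord (l' ++ m) := by
          intro ν
          have h := hl ν
          have h' := hcount ν
          rw [hs.perm.count_eq] at h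
          simp only [List.map_append, List.map_cons, List.map_nil, List.count_append,
            List.count_cons, List.count_nil, hα'] at h h' ⊢
          obtain ⟨k, hk⟩ := h
          by_cases hν : α.nm = ν
          · simp only [hν, beq_self_eq_true, if_true] at hk h'
            -- Exactly two letters, `a` and `α`, have been lost, both of this norm.
            exact ⟨k - 1, by omega⟩
          · have hν' : (α.nm == ν) = false := by simpa using hν
            simp only [hν'] at hk h'
            exact ⟨k, by simp at hk h'; omega⟩
        have hlen : (l' ++ m).length < n := by
          have e1 := hs.length_eq
          have e2 := hs'.length_eq
          simp at e1 e2 ⊢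
          omega
        rcases ih _ hlen hev rfl with h | ⟨σ, hσ, u, hu, hyp⟩
        · left
          rw [← hconj] at h
          simpa using h
        -- Hyperbolicity is carried back to the original element by undoing the conjugation.
        · have hyp' := hyp.conj S₀ (wordUnit [α])⁻¹
          rw [inv_inv] at hyp'
          refine Or.inr ⟨σ, hσ, _, ?_, hyp'⟩
          rw [QuotientGroup.mk_mul, QuotientGroup.mk_mul, hu, ← hconj, QuotientGroup.mk_inv, ← presHom_wordPres,
            show wordPres [α] = PresentedGroup.of α by simp [wordPres]]
          simp [mul_assoc]

/-! ### The subgroup `Γ'_S` -/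

lemma exists_evenWord_of_mem {g : Lam c S₀} (hg : g ∈ Gam' c S₀) :
    ∃ l : List (Idx c S₀), EvenWord l ∧ presHom c S₀ (wordPres l) = g := by
  classical
  induction hg using Subgroup.closure_induction with
  | mem x hx =>
    obtain ⟨τ, -, _, ⟨α, hα, rfl⟩, _, ⟨β, hβ, rfl⟩, rfl⟩ := hx
    refine ⟨[α, β], fun ν => ?_, ?_⟩
    · have hα' : α.nm = (τ : F)⁻¹ := hα
      have hβ' : β.nm = (τ : F)⁻¹ := hβ
      by_cases hν : (τ : F)⁻¹ = ν <;> simp [hα', hβ', hν]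
    · simp [wordPres, presHom_of]
  | one => exact ⟨[], fun ν => by simp, by simp [wordPres]⟩
  | mul x y _ _ hx hy =>
    obtain ⟨l, hl, rfl⟩ := hx
    obtain ⟨l', hl', rfl⟩ := hy
    exact ⟨l ++ l', fun ν => by simpa using (hl ν).add (hl' ν), by
      rw [wordPres_append, map_mul]⟩
  | inv x _ hx =>
    obtain ⟨l, hl, rfl⟩ := hx
    refine ⟨l.reverse, fun ν => by simpa using hl ν, ?_⟩
    rw [wordPres_reverse, map_inv]

lemma wordPres_mem_of_even_length {τ : Fˣ} (hτ : τ ∈ S₀) (l : List (Idx c S₀))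
    (hl : ∀ α ∈ l, α.nm = (τ : F)⁻¹) (he : Even l.length) :
    presHom c S₀ (wordPres l) ∈ Gam' c S₀ := by
  match l, he with
  | [], _ => simp [wordPres, one_mem]
  | [_], he => simp at he
  | α :: β :: l, he =>
    rw [wordPres_cons, wordPres_cons, ← mul_assoc, map_mul, map_mul, presHom_of, presHom_of]
    refine mul_mem (Subgroup.subset_closure ⟨τ, hτ, _, gen_mem_PA c S₀ (hl α (by simp)), _,
      gen_mem_PA c S₀ (hl β (by simp)), rfl⟩)
      (wordPres_mem_of_even_length hτ l (fun γ hγ => hl γ (by simp [hγ])) ?_)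
    simpa [parity_simps] using he

/-- Once the letters of one norm stand at the end, their number is even and they pair off into
generators of `Γ'_S`. The rest is a shorter even word. -/
lemma EvenWord.mem {l : List (Idx c S₀)} (hl : EvenWord l) :
    presHom c S₀ (wordPres l) ∈ Gam' c S₀ := by
  classical
  induction hn : l.length using Nat.strong_induction_on generalizing l with
  | _ n ih =>
    cases l with
    | nil => simp [wordPres, one_mem]
    | cons α l =>
      obtain ⟨τ, hτ, hα⟩ := α.exists_nm_eq
      obtain ⟨l₁, l₂, h₁, h₂, hs⟩ := exists_swapEq_append (τ : F)⁻¹ (α :: l)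
      have hc₁ : (l₁.map Idx.nm).count (τ : F)⁻¹ = 0 :=
        List.count_eq_zero.2 fun hm => by
          obtain ⟨β, hβ, hβ'⟩ := List.mem_map.1 hm
          exact h₁ β hβ hβ'
      have hm₂ : l₂.map Idx.nm = List.replicate l₂.length (τ : F)⁻¹ :=
        List.eq_replicate_iff.2 ⟨by simp, fun x hx => by
          obtain ⟨β, hβ, rfl⟩ := List.mem_map.1 hx
          exact h₂ β hβ⟩
      have hcount : ∀ ν, ((α :: l).map Idx.nm).count ν =
          (l₁.map Idx.nm).count ν + (l₂.map Idx.nm).count ν := fun ν => by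
        rw [hs.perm.count_eq, List.map_append, List.count_append]
      have he₂ : Even l₂.length := by
        have h := hl (τ : F)⁻¹
        rwa [hcount, hc₁, hm₂, List.count_replicate_self, zero_add] at h
      have hne : l₂.length ≠ 0 := by
        intro h0
        have h := hcount (τ : F)⁻¹
        rw [hc₁, List.length_eq_zero_iff.1 h0] at h
        simp [hα] at h
      rw [hs.pres, wordPres_append, map_mul]
      refine mul_mem (ih l₁.length ?_ (fun ν => ?_) rfl) (wordPres_mem_of_even_length hτ l₂ h₂ he₂)
      · have := hs.length_eq
        rw [List.length_append] at this
        omega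
      · by_cases hν : (τ : F)⁻¹ = ν
        · rw [← hν, hc₁]; exact Even.zero
        · have h := hl ν
          rwa [hcount, hm₂, List.count_replicate, if_neg (by simpa using hν), add_zero] at h

/-! ### The sign homomorphism -/

open Classical in
/-- The sign of a letter at the places of `S₀`. -/
def letterSign (α : Idx c S₀) : S₀ → ℤˣ := fun τ => if α.nm = ((τ : Fˣ) : F)⁻¹ then -1 else 1

variable (c S₀) in
/-- The homomorphism to `{±1}^{S₀}` counting the letters at each place modulo two. -/
def signHom : PresentedGroup (rels c S₀) →* (S₀ → ℤˣ) :=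
  PresentedGroup.toGroup (f := letterSign) (by
    rintro _ (⟨α, rfl⟩ | ⟨α, β, γ, δ, hne, hγ, hδ, rfl⟩)
    · rw [map_pow, FreeGroup.lift_apply_of]
      exact funext fun τ => Int.units_sq _
    -- An exchange only swaps the two norms, which is invisible in a commutative target.
    · have hs : α.1 + β.1 ≠ 0 := add_ne_zero_of_norm_ne hne
      have eγ : γ.nm = β.nm := by
        rw [Idx.nm, hγ, norm_zeta_mul (val_ne_zero β) hs, Idx.nm]
      have eδ : δ.nm = α.nm := by
        rw [Idx.nm, hδ, norm_zeta_mul (val_ne_zero α) (by rwa [add_comm]), Idx.nm]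
      rw [map_mul, map_inv, mul_inv_eq_one, map_mul, map_mul]
      rw [FreeGroup.lift_apply_of, FreeGroup.lift_apply_of, FreeGroup.lift_apply_of,
        FreeGroup.lift_apply_of, mul_comm]
      unfold letterSign
      rw [eγ, eδ])

lemma signHom_of (α : Idx c S₀) : signHom c S₀ (PresentedGroup.of α) = letterSign α :=
  PresentedGroup.toGroup.of _

open Classical in
lemma signHom_wordPres (l : List (Idx c S₀)) (τ : S₀) :
    signHom c S₀ (wordPres l) τ = (-1) ^ (l.map Idx.nm).count ((τ : Fˣ) : F)⁻¹ := by
  induction l with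
  | nil => simp [wordPres]
  | cons α l ih =>
    rw [wordPres_cons, map_mul, Pi.mul_apply, ih, signHom_of, List.map_cons, List.count_cons,
      pow_add, mul_comm, letterSign]
    by_cases h : α.nm = ((τ : Fˣ) : F)⁻¹ <;> simp [h]

lemma signHom_wordPres_eq_one_iff (l : List (Idx c S₀)) :
    signHom c S₀ (wordPres l) = 1 ↔ EvenWord l := by
  classical
  constructor
  · intro h ν
    by_cases hν : ν ∈ l.map Idx.nm
    · obtain ⟨α, -, rfl⟩ := List.mem_map.1 hν
      obtain ⟨τ, hτ, hα⟩ := α.exists_nm_eq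
      have h1 := congrFun h ⟨τ, hτ⟩
      rw [signHom_wordPres, Pi.one_apply] at h1
      rw [hα]
      exact (neg_one_pow_eq_one_iff_even (by decide)).1 h1
    · rw [List.count_eq_zero.2 hν]; exact Even.zero
  · intro h
    ext τ
    rw [signHom_wordPres, (h _).neg_one_pow, Pi.one_apply]

/-- Every place of `S₀` has a letter: in a finite field of characteristic two `τ⁻¹` is a square
`r²`, which is the norm of `r`. -/
lemma signHom_surjective [Finite F] : Function.Surjective (signHom c S₀) := by
  classical
  rw [← MonoidHom.range_eq_top, eq_top_iff]
  intro s _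
  rw [← Finset.univ_prod_mulSingle s]
  refine Subgroup.prod_mem _ fun τ _ => ?_
  rcases Int.units_eq_one_or (s τ) with h | h
  · rw [h, Pi.mulSingle_one]; exact one_mem _
  · obtain ⟨r, hr⟩ : ∃ r : F, ((τ : Fˣ) : F)⁻¹ = r * r :=
      FiniteField.isSquare_of_char_two (ringChar.eq F 2) _
    let α : Idx c S₀ := ⟨⟨r, 0⟩, τ, τ.2, by rw [hr]; simp [QuadraticAlgebra.norm_def]⟩
    have hα : α.nm = ((τ : Fˣ) : F)⁻¹ := by rw [hr]; simp [Idx.nm, α, QuadraticAlgebra.norm_def]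
    refine ⟨PresentedGroup.of α, ?_⟩
    rw [signHom_of, h]
    ext σ
    rw [letterSign, hα, Pi.mulSingle_apply]
    have : ((τ : Fˣ) : F)⁻¹ = ((σ : Fˣ) : F)⁻¹ ↔ σ = τ := by
      rw [inv_inj, Units.val_inj, Subtype.coe_inj, eq_comm]
    simp only [this]

end Even

/-! ### The main theorem -/

section Main

variable {F : Type*} [Field F] (c : F) (S₀ : Finset Fˣ)

lemma Gam'_le_Gam : Gam' c S₀ ≤ Gam c S₀ := by
  refine (Subgroup.closure_le _).2 ?_
  rintro _ ⟨τ, hτ, a, ha, a', ha', rfl⟩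
  exact mul_mem (Subgroup.subset_closure (Set.mem_biUnion hτ ha))
    (Subgroup.subset_closure (Set.mem_biUnion hτ ha'))

variable [CharP F 2] [Fact (Irreducible (X ^ 2 + X + C c : F[X]))]

/-- An element of `Γ'_S` is the image of an even word. By injectivity of `presHom`, any other word
for it has the same class in the presented group, hence the same sign. -/
lemma ker_signHom_presEquiv : ((signHom c S₀).comp (presEquiv c S₀).symm.toMonoidHom).ker =
    (Gam' c S₀).subgroupOf (Gam c S₀) := by
  ext g
  obtain ⟨x, rfl⟩ := (presEquiv c S₀).surjective g
  obtain ⟨l, rfl⟩ := exists_wordPres_eq c S₀ x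
  rw [MonoidHom.mem_ker, Subgroup.mem_subgroupOf, presEquiv_apply]
  have : ((signHom c S₀).comp (presEquiv c S₀).symm.toMonoidHom)
      (presEquiv c S₀ (wordPres l)) = signHom c S₀ (wordPres l) := by simp
  rw [this]
  refine ⟨fun h => ((signHom_wordPres_eq_one_iff l).1 h).mem, fun h => ?_⟩
  obtain ⟨l', hl', h'⟩ := exists_evenWord_of_mem h
  rw [← presHom_injective c S₀ h', signHom_wordPres_eq_one_iff]
  exact hl'

lemma exists_isHyp_of_mem {g : Lam c S₀} (hg : g ∈ Gam' c S₀) (h1 : g ≠ 1) :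
    ∃ τ ∈ S₀, IsHypClass c S₀ τ g := by
  obtain ⟨l, hl, rfl⟩ := exists_evenWord_of_mem hg
  refine hl.eq_one_or_isHypClass.resolve_left fun h => h1 ?_
  rw [h, map_one]

end Main

end QuatLattice

/-- Here `F = 𝔽_q` with `q` even, and `S = {0, ∞} ∪ S₀`. -/
theorem theorem2p16 {F : Type*} [Field F] [Finite F] [CharP F 2] (c : F)
    [Fact (Irreducible (X ^ 2 + X + C c : F[X]))] (S₀ : Finset Fˣ) :
    -- `Γ'_S` is a normal subgroup of `Γ_S` with quotient `{±1}^{S₀}`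
    (QuatLattice.Gam' c S₀ ≤ QuatLattice.Gam c S₀ ∧
      ∃ _ : ((QuatLattice.Gam' c S₀).subgroupOf (QuatLattice.Gam c S₀)).Normal,
        Nonempty ((QuatLattice.Gam c S₀ ⧸
          (QuatLattice.Gam' c S₀).subgroupOf (QuatLattice.Gam c S₀)) ≃* (S₀ → ℤˣ))) ∧
    -- the quaternion algebra splits at all `τ ∈ S₀`, and however it is identified there with
    -- `M₂(K_τ)`, no nontrivial element of `Γ'_S` maps a cell of the product of trees to itself
    ((∀ τ : S₀, Nonempty (QuatLattice.Splitting c (τ : Fˣ))) ∧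
      ∀ φ : ∀ τ : S₀, QuatLattice.Splitting c (τ : Fˣ),
        ∀ g ∈ QuatLattice.Gam' c S₀, g ≠ 1 → ∀ D : Set (QuatLattice.PT S₀),
          QuatLattice.IsCell S₀ D → QuatLattice.act S₀ φ g '' D ≠ D) ∧
    -- `Γ'_S` is torsion-free
    (∀ g ∈ QuatLattice.Gam' c S₀, IsOfFinOrder g → g = 1) ∧
    -- the presentation of `Γ_S`
    ∃ e : PresentedGroup (QuatLattice.rels c S₀) ≃* QuatLattice.Gam c S₀,
      ∀ α : QuatLattice.Idx c S₀,
        (e (PresentedGroup.of α) : QuatLattice.Lam c S₀) = QuatLattice.gen c S₀ α := by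
  open QuatLattice in
  have hker := ker_signHom_presEquiv c S₀
  have hc : c ≠ 0 := by
    rintro rfl
    have h : Fact (∀ r : F, r ^ 2 ≠ 0 + 1 * r) := inferInstance
    exact h.out 0 (by simp)
  have hN : ((Gam' c S₀).subgroupOf (Gam c S₀)).Normal := hker ▸ MonoidHom.normal_ker _
  refine ⟨⟨Gam'_le_Gam c S₀, hN, ⟨?_⟩⟩,
    ⟨fun τ => nonempty_splitting c hc τ, ?_⟩, ?_, presEquiv c S₀, presHom_of c S₀⟩
  · refine (QuotientGroup.quotientMulEquivOfEq hker.symm).trans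
      (QuotientGroup.quotientKerEquivOfSurjective _ ?_)
    exact signHom_surjective.comp (presEquiv c S₀).symm.surjective
  · intro φ g hg h1 D hD
    obtain ⟨τ, hτ, u, rfl, hu⟩ := exists_isHyp_of_mem c S₀ hg h1
    exact IsHyp.act_image_ne S₀ (τ := ⟨τ, hτ⟩) hu φ hD
  · intro g hg hfin
    by_contra h1
    obtain ⟨τ, hτ, u, rfl, hu⟩ := exists_isHyp_of_mem c S₀ hg h1
    obtain ⟨n, hn, hpow⟩ := isOfFinOrder_iff_pow_eq_one.1 hfin
    rw [← QuotientGroup.mk_pow, QuotientGroup.eq_one_iff] at hpow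
    exact (hu.pow S₀ hn.ne').notMem_scalars S₀ hpow

end
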